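/- Let $\Phi_1=\{q^2 : q \text{ is a prime power},\ q\equiv 1 \pmod 4\}$, $\Phi_2=\{n^4 : n\in\mathbb{N} \text{ odd}\}\cup\{9n^4 : n\in\mathbb{N}\text{ odd}\}$ and $\Phi_3=\{5\}$. For a finite abelian group $(G,+)$, a family $B_1,\dots,B_8$ of (not necessarily distinct) subsets of $G$ is a *difference family* if there is an integer $\lambda\ge 0$ such that every $g\in G\setminus\{0\}$ occurs exactly $\lambda$ times in the list of differences $x-y$, $x,y\in B_i$, $x\neq y$, $i=1,\dots,8$. It is *of type $H_8^\ast$* if moreover $\lambda$ can be chosen as $\sum_{i=1}^8|B_i|-\frac{8(|G|+1)}{4}$, and it is *symmetric* if $B_i=\{-x : x\in B_i\}$ for every $i$. **Theorem.** For any $u\in\Phi_1\cup\Phi_2$ and any $v\in\Phi_1\cup\Phi_2\cup\Phi_3$ there exist an abelian group $G$ of order $uv$ and a symmetric difference family of type $H_8^\ast$ in $G$. -/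

import Mathlib

/-- The family `B` of `ℓ` blocks (repetitions and empty blocks are allowed) is a difference family
in `G`: the list of differences `x - y` with `x, y ∈ B i`, `x ≠ y`, `i = 1, …, ℓ`, represents
every nonzero element of `G` exactly `lam` times. The block sizes are `k i = (B i).card`. -/
def IsDifferenceFamily {G : Type*} [AddCommGroup G] [DecidableEq G] {ℓ : ℕ}
    (B : Fin ℓ → Finset G) (lam : ℕ) : Prop :=
  ∀ g : G, g ≠ 0 →
    ∑ i, ((B i ×ˢ B i).filter fun p => p.1 ≠ p.2 ∧ p.1 - p.2 = g).card = lam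

/-- The family `B` is symmetric: every block satisfies `B i = {-x : x ∈ B i}`. -/
def IsSymmetricFamily {G : Type*} [AddCommGroup G] [DecidableEq G] {ℓ : ℕ}
    (B : Fin ℓ → Finset G) : Prop :=
  ∀ i, B i = (B i).image fun x => -x

/-- For `ℓ = 2, 4, 8`, the family `B` of `ℓ` blocks is a difference family of type `H_ℓ^*`:
it is a difference family whose parameters satisfy `∑ k_i - ℓ (|G| + 1) / 4 = λ`. The equation is
read in `ℚ`, so that neither the subtraction nor the division is truncated. -/
def IsTypeHStar {G : Type*} [AddCommGroup G] [Fintype G] [DecidableEq G] {ℓ : ℕ}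
    (B : Fin ℓ → Finset G) : Prop :=
  (ℓ = 2 ∨ ℓ = 4 ∨ ℓ = 8) ∧
    ∃ lam : ℕ, IsDifferenceFamily B lam ∧
      (∑ i, ((B i).card : ℚ)) - (ℓ : ℚ) * ((Fintype.card G : ℚ) + 1) / 4 = (lam : ℚ)

/-- Squares of prime powers `q ≡ 1 (mod 4)`. -/
def Phi1 : Set ℕ := {v | ∃ q : ℕ, IsPrimePow q ∧ q ≡ 1 [MOD 4] ∧ v = q ^ 2}

/-- The numbers `n ^ 4` and `9 n ^ 4` with `n` odd. -/
def Phi2 : Set ℕ := {v | ∃ n : ℕ, n ≡ 1 [MOD 2] ∧ v = n ^ 4} ∪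
  {v | ∃ n : ℕ, n ≡ 1 [MOD 2] ∧ v = 9 * n ^ 4}

/-- The set containing only `5`. -/
def Phi3 : Set ℕ := {5}

/-!
Eight symmetric blocks form a difference family of type `H₈*` on `G` as soon as their sign functions
`f₁, …, f₈` satisfy `∑ fᵢ² = 8 (|G| + 1) - 8 J` in the group ring `ℤ[G]`, where `J` is the sum of all
group elements (`exists_family_of_signs`). On a product `U × V` such functions are assembled from
tensor products of functions on the factors, so that the identity reduces to two quadratic
identities on each factor.

A *sign quadruple* on `U` consists of even functions `E, O, a, b` with values `0, ±1` such that
`a² + b² = |U| - J` and `E² + O² = |U| + J`, where the supports of `a` and `b` partition `U \ {0}`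
and those of `O` and `E` are obtained by adding the origin. For two quadruples, the four functions
`(aE' + bO') ± (Eb' + Oa')` and `(aO' - bE') ± (Ea' - Ob')` are `±1` away from the origin, and their
squares add up to `2 (a² + b²)(E'² + O'²) + 2 (E² + O²)(a'² + b'²) = 4 (|U × V| - J)`; adding and
subtracting them from the identity element gives the eight sign functions
(`exists_family_of_quadruples`). A similar formula handles the product with `ZMod 5`
(`exists_family_of_quadruple_five`). It remains to find quadruples.

The functions `E` and `O` are signed sums of lines in a plane `K × K` over a finite field `K`. With
an odd number of lines the signs can be chosen to have sum `1`, and the result is an eigenfunction of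
the symplectic Fourier transform (`exists_line_function`). If `|K| ≡ 1 (mod 4)`, the `|K| + 1` lines
split into two odd halves, so any suitable pair `a, b` that is supported on halves can be completed
(`exists_quadruple_of_pair`).

* For order `q²` with `q ≡ 1 (mod 4)`, take for `a` and `b` the real and imaginary parts of a quartic
  character `θ` of the field with `q²` elements; `a² + b² = q² - J` is the evaluation of the Jacobi sum
  of `θ` and `θ⁻¹` (`hasSignQuadruple_sq`).
* For order `n⁴` or `9 n⁴` quadruples have to be multiplied, which is possible for *orthogonal*
  quadruples, where also `ab = aO = bE = 0` and `EO = J` (`IsOrthogonalQuadruple.prod`). An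
  orthogonal quadruple of order `9` can be written down. For order `p⁴`, let `K` be the field with
  `p²` elements. The conference matrix given by the quadratic character on the projective line over
  `K` has sign eigenvectors `v` and `w` for both of its eigenvalues `p` and `-p`, obtained from
  functions on `K` that are constant on the translates of the prime field and from their twists by a
  nonsquare (`exists_conference_eigenvectors`). Then `(v + w) / 2` and `(v - w) / 2` have
  complementary supports, and the Fourier transform interchanges the corresponding functions on the
  plane (`hasOrthogonalQuadruple_fourth_power`).
-/

/-! ### Integer-valued functions as elements of the group ring -/

/-- The element `∑ x, f x · [x]` of the integral group ring of a finite additive group. Products of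
such elements are convolutions of functions. -/
noncomputable def groupSum {G : Type*} [Fintype G] (f : G → ℤ) : AddMonoidAlgebra ℤ G :=
  AddMonoidAlgebra.ofCoeff (Finsupp.equivFunOnFinite.symm f)

section GroupSum

variable {G : Type*} [Fintype G]

@[simp] lemma coeff_groupSum (f : G → ℤ) (x : G) : (groupSum f).coeff x = f x := rfl

lemma groupSum_add (f g : G → ℤ) : groupSum (fun x => f x + g x) = groupSum f + groupSum g := by
  ext x; simp

lemma groupSum_sub (f g : G → ℤ) : groupSum (fun x => f x - g x) = groupSum f - groupSum g := by
  ext x; simp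

lemma groupSum_neg (f : G → ℤ) : groupSum (fun x => -f x) = -groupSum f := by
  ext x; simp

lemma groupSum_eq_sum (f : G → ℤ) :
    groupSum f = ∑ x, AddMonoidAlgebra.single x (f x) := by
  classical
  ext x
  simp [AddMonoidAlgebra.coeff_sum, AddMonoidAlgebra.coeff_single, Finsupp.single_apply]

lemma groupSum_delta [AddCommGroup G] [DecidableEq G] :
    groupSum (fun x : G => if x = 0 then 1 else 0) = 1 := by
  ext x
  simp [AddMonoidAlgebra.one_def, Finsupp.single_apply, eq_comm]

lemma coeff_groupSum_mul [AddCommGroup G] (f g : G → ℤ) (x : G) :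
    (groupSum f * groupSum g).coeff x = ∑ y, f y * g (x - y) := by
  classical
  rw [groupSum_eq_sum f, groupSum_eq_sum g, Finset.sum_mul_sum]
  simp only [AddMonoidAlgebra.single_mul_single, AddMonoidAlgebra.coeff_sum,
    AddMonoidAlgebra.coeff_single, Finsupp.finsetSum_apply, Finsupp.single_apply]
  refine Finset.sum_congr rfl fun y _ => ?_
  rw [Finset.sum_eq_single (x - y)]
  · simp
  · intro z _ hz
    rw [if_neg]
    rintro rfl
    simp at hz
  · simp

/-- The sum of all group elements. -/
noncomputable def allSum (G : Type*) [Fintype G] : AddMonoidAlgebra ℤ G := groupSum fun _ => 1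

@[simp] lemma coeff_allSum (x : G) : (allSum G).coeff x = 1 := rfl

variable {U V : Type*} [AddCommGroup U] [Fintype U] [AddCommGroup V] [Fintype V]

variable (U V) in
/-- The inclusion of the group ring of the first factor of a direct product. -/
noncomputable def inlRing : AddMonoidAlgebra ℤ U →+* AddMonoidAlgebra ℤ (U × V) :=
  AddMonoidAlgebra.mapDomainRingHom ℤ (AddMonoidHom.inl U V)

variable (U V) in
/-- The inclusion of the group ring of the second factor of a direct product. -/
noncomputable def inrRing : AddMonoidAlgebra ℤ V →+* AddMonoidAlgebra ℤ (U × V) :=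
  AddMonoidAlgebra.mapDomainRingHom ℤ (AddMonoidHom.inr U V)

lemma groupSum_prod (f : U → ℤ) (g : V → ℤ) :
    groupSum (fun p : U × V => f p.1 * g p.2) =
      inlRing U V (groupSum f) * inrRing U V (groupSum g) := by
  rw [groupSum_eq_sum, groupSum_eq_sum f, groupSum_eq_sum g, map_sum, map_sum,
    Finset.sum_mul_sum, Fintype.sum_prod_type]
  simp [inlRing, inrRing, AddMonoidAlgebra.mapDomain_single, AddMonoidAlgebra.single_mul_single]

lemma allSum_prod : allSum (U × V) = inlRing U V (allSum U) * inrRing U V (allSum V) := by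
  have := groupSum_prod (fun _ : U => 1) (fun _ : V => 1)
  simpa [allSum] using this

end GroupSum

/-! ### From sign functions to difference families -/

/-- The blocks `{x | f i x = 1}` of eight even sign functions form a family of type `H₈*` as soon as
the autocorrelations of the functions add up to `-8` away from the origin. -/
lemma exists_family_of_signs {G : Type} [AddCommGroup G] [Fintype G] [DecidableEq G]
    (f : Fin 8 → G → ℤ) (hf : ∀ i x, f i x ^ 2 = 1) (hs : ∀ i x, f i (-x) = f i x)
    (h : ∑ i, groupSum (f i) ^ 2 = 8 * ((Fintype.card G : AddMonoidAlgebra ℤ G) + 1)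
      - 8 * allSum G) :
    ∃ B : Fin 8 → Finset G, IsSymmetricFamily B ∧ IsTypeHStar B := by
  rcases subsingleton_or_nontrivial G with hG | hG
  · -- In the trivial group only the size condition matters, and full blocks satisfy it.
    refine ⟨fun _ => Finset.univ, fun i => ?_, Or.inr (Or.inr rfl), 4, fun g hg => ?_, ?_⟩
    · ext x; simp [Subsingleton.elim x 0]
    · exact absurd (Subsingleton.elim g 0) hg
    · have : Fintype.card G = 1 := Fintype.card_eq_one_iff_nonempty_unique.2 ⟨⟨⟨0⟩, fun x => Subsingleton.elim _ _⟩⟩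
      simp [this]; norm_num
  set B : Fin 8 → Finset G := fun i => Finset.univ.filter fun x => f i x = 1 with hB
  set N : G → ℕ := fun g =>
    ∑ i, ((B i ×ˢ B i).filter fun p => p.1 ≠ p.2 ∧ p.1 - p.2 = g).card with hN
  have ind : ∀ i x, f i x = 2 * (if x ∈ B i then 1 else 0) - 1 := by
    intro i x
    rcases Int.isUnit_iff.1 (IsUnit.of_mul_eq_one _ ((pow_two _).symm.trans (hf i x))) with h | h <;> simp [hB, h]
  have key : ∀ g : G, g ≠ 0 →
      (N g : ℤ) = ∑ i, ((B i).card : ℤ) - 2 * (Fintype.card G + 1) := by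
    intro g hg
    have cnt : ∀ i, (((B i ×ˢ B i).filter fun p => p.1 ≠ p.2 ∧ p.1 - p.2 = g).card : ℤ) =
        ∑ y, (if y ∈ B i then 1 else 0) * (if y - g ∈ B i then 1 else 0) := by
      intro i
      have : ((B i ×ˢ B i).filter fun p => p.1 ≠ p.2 ∧ p.1 - p.2 = g) =
          ((Finset.univ.filter fun y => y ∈ B i ∧ y - g ∈ B i).image fun y => (y, y - g)) := by
        ext ⟨x, y⟩
        simp only [Finset.mem_filter, Finset.mem_product, Finset.mem_image, Finset.mem_univ,
          true_and, Prod.mk.injEq]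
        constructor
        · rintro ⟨⟨hx, hy⟩, -, rfl⟩
          exact ⟨x, ⟨hx, by simpa using hy⟩, rfl, by simp⟩
        · rintro ⟨z, ⟨h1, h2⟩, rfl, rfl⟩
          refine ⟨⟨h1, h2⟩, ?_, by simp⟩
          intro h
          exact hg (by simpa using sub_eq_self.1 h.symm)
      rw [this, Finset.card_image_of_injective _ fun a b h => (Prod.mk.inj h).1, Finset.card_filter]
      push_cast
      refine Finset.sum_congr rfl fun y _ => ?_
      by_cases h1 : y ∈ B i <;> by_cases h2 : y - g ∈ B i <;> simp only [h1, h2] <;> rfl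
    have card : ∀ i, ((B i).card : ℤ) = ∑ y, (if y ∈ B i then 1 else 0) := by
      intro i; simp
    have card' : ∀ i, ((B i).card : ℤ) = ∑ y, (if y - g ∈ B i then 1 else 0) := by
      intro i
      rw [card, ← Equiv.sum_comp (Equiv.subRight g)]; rfl
    have auto : ∀ i, (groupSum (f i) ^ 2).coeff g =
        4 * (((B i ×ˢ B i).filter fun p => p.1 ≠ p.2 ∧ p.1 - p.2 = g).card : ℤ)
          - 4 * (B i).card + Fintype.card G := by
      intro i
      have h1 : (groupSum (f i) ^ 2).coeff g = ∑ y, f i y * f i (y - g) := by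
        rw [pow_two, coeff_groupSum_mul]
        refine Finset.sum_congr rfl fun y _ => ?_
        rw [← neg_sub y g, hs]
      have h2 : ∀ y, f i y * f i (y - g) = 4 * ((if y ∈ B i then 1 else 0) *
          (if y - g ∈ B i then 1 else 0)) - 2 * (if y ∈ B i then 1 else 0)
          - 2 * (if y - g ∈ B i then 1 else 0) + 1 := by
        intro y
        rw [ind i y, ind i (y - g)]; ring
      rw [h1, Finset.sum_congr rfl fun y _ => h2 y, Finset.sum_add_distrib,
        Finset.sum_sub_distrib, Finset.sum_sub_distrib, ← Finset.mul_sum, ← Finset.mul_sum,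
        ← Finset.mul_sum, ← cnt, ← card, ← card']
      simp; ring
    have h3 := congrArg (fun z => z.coeff g) h
    have h4 : ((8 : AddMonoidAlgebra ℤ G) * ((Fintype.card G : AddMonoidAlgebra ℤ G) + 1)
      - 8 * allSum G).coeff g = -8 := by
      have e1 : (8 : AddMonoidAlgebra ℤ G) * ((Fintype.card G : AddMonoidAlgebra ℤ G) + 1) =
          (8 * (Fintype.card G + 1) : ℤ) • 1 := by simp
      have e2 : (8 : AddMonoidAlgebra ℤ G) * allSum G = (8 : ℤ) • allSum G := by simp
      rw [e1, e2]
      simp only [AddMonoidAlgebra.coeff_sub, AddMonoidAlgebra.coeff_smul, Finsupp.sub_apply,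
        Finsupp.smul_apply, coeff_allSum, AddMonoidAlgebra.one_def, AddMonoidAlgebra.coeff_single,
        Finsupp.single_eq_of_ne hg]
      rfl
    simp only [h4, AddMonoidAlgebra.coeff_sum, Finsupp.finsetSum_apply, auto,
      Finset.sum_add_distrib, Finset.sum_sub_distrib, ← Finset.mul_sum] at h3
    simp only [hN]
    push_cast
    simp at h3
    linarith
  obtain ⟨g₀, hg₀⟩ := exists_ne (0 : G)
  refine ⟨B, fun i => ?_, Or.inr (Or.inr rfl), N g₀, fun g hg => ?_, ?_⟩
  · ext x
    simp only [hB, Finset.mem_filter, Finset.mem_univ, true_and, Finset.mem_image]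
    constructor
    · intro hx
      exact ⟨-x, by rw [hs, hx], neg_neg x⟩
    · rintro ⟨y, hy, rfl⟩
      rw [hs, hy]
  · have := (key g hg).trans (key g₀ hg₀).symm
    exact_mod_cast this
  · have := key g₀ hg₀
    have h5 : ((N g₀ : ℤ) : ℚ) = ((∑ i, ((B i).card : ℤ) - 2 * (Fintype.card G + 1) : ℤ) : ℚ) := by
      rw [this]
    push_cast at h5 ⊢
    rw [h5]; ring

/-! ### Quadruples of partial sign functions -/

/-- Four even functions `E, O, a, b : U → {0, ±1}` on a finite abelian group. Away from the origin
the supports of `a` and `b` are complementary, `O` has the support of `a`, and `E` that of `b`; at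
the origin `E` and `O` are `1` whereas `a` and `b` vanish. In the group ring, with `J` the sum of
all elements, `a² + b² = |U| - J` and `E² + O² = |U| + J`. -/
structure IsSignQuadruple {U : Type*} [AddCommGroup U] [Fintype U] (E O a b : U → ℤ) : Prop where
  neg_E : ∀ x, E (-x) = E x
  neg_O : ∀ x, O (-x) = O x
  neg_a : ∀ x, a (-x) = a x
  neg_b : ∀ x, b (-x) = b x
  values : ∀ x, (x = 0 ∧ E x = 1 ∧ O x = 1 ∧ a x = 0 ∧ b x = 0) ∨
    (x ≠ 0 ∧ E x = 0 ∧ O x ^ 2 = 1 ∧ a x ^ 2 = 1 ∧ b x = 0) ∨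
    (x ≠ 0 ∧ E x ^ 2 = 1 ∧ O x = 0 ∧ a x = 0 ∧ b x ^ 2 = 1)
  sq_ab : groupSum a ^ 2 + groupSum b ^ 2 = (Fintype.card U : AddMonoidAlgebra ℤ U) - allSum U
  sq_EO : groupSum E ^ 2 + groupSum O ^ 2 = (Fintype.card U : AddMonoidAlgebra ℤ U) + allSum U

/-- A sign quadruple whose members are pairwise orthogonal in the group ring wherever possible. At
every nontrivial character exactly one of `E, O` and one of `a, b` is then nonzero, and `a` goes
with `E`. These stronger relations are inherited by products of groups. -/
structure IsOrthogonalQuadruple {U : Type*} [AddCommGroup U] [Fintype U] (E O a b : U → ℤ) : Prop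
    extends IsSignQuadruple E O a b where
  mul_ab : groupSum a * groupSum b = 0
  mul_aO : groupSum a * groupSum O = 0
  mul_bE : groupSum b * groupSum E = 0
  mul_EO : groupSum E * groupSum O = allSum U
  sq_a : groupSum a ^ 2 = groupSum E ^ 2 - allSum U
  sq_b : groupSum b ^ 2 = groupSum O ^ 2 - allSum U

section Product

variable {U V : Type*} [AddCommGroup U] [Fintype U] [AddCommGroup V] [Fintype V]

/-- The product of two orthogonal quadruples, with cross terms in all four members chosen so that
the supports tile the product group. -/
theorem IsOrthogonalQuadruple.prod {E O a b : U → ℤ} {E' O' a' b' : V → ℤ}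
    (h : IsOrthogonalQuadruple E O a b) (h' : IsOrthogonalQuadruple E' O' a' b') :
    IsOrthogonalQuadruple (U := U × V)
      (fun p => E p.1 * E' p.2 + b p.1 * a' p.2) (fun p => O p.1 * O' p.2 + a p.1 * b' p.2)
      (fun p => a p.1 * E' p.2 + O p.1 * a' p.2) (fun p => b p.1 * O' p.2 + E p.1 * b' p.2) := by
  have rel {x y : AddMonoidAlgebra ℤ U} (e : x = y) : inlRing U V x = inlRing U V y := by rw [e]
  have rel' {x y : AddMonoidAlgebra ℤ V} (e : x = y) : inrRing U V x = inrRing U V y := by rw [e]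
  have r1 := rel h.sq_EO
  have r2 := rel h.mul_ab
  have r3 := rel h.mul_aO
  have r4 := rel h.mul_bE
  have r5 := rel h.mul_EO
  have r6 := rel h.sq_a
  have r7 := rel h.sq_b
  have s1 := rel' h'.sq_EO
  have s2 := rel' h'.mul_ab
  have s3 := rel' h'.mul_aO
  have s4 := rel' h'.mul_bE
  have s5 := rel' h'.mul_EO
  have s6 := rel' h'.sq_a
  have s7 := rel' h'.sq_b
  simp only [map_add, map_sub, map_mul, map_pow, map_natCast, map_zero]
    at r1 r2 r3 r4 r5 r6 r7 s1 s2 s3 s4 s5 s6 s7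
  have mulE : groupSum (fun p : U × V => E p.1 * E' p.2 + b p.1 * a' p.2) =
      inlRing U V (groupSum E) * inrRing U V (groupSum E') +
        inlRing U V (groupSum b) * inrRing U V (groupSum a') := by
    rw [groupSum_add, groupSum_prod, groupSum_prod]
  have mulO : groupSum (fun p : U × V => O p.1 * O' p.2 + a p.1 * b' p.2) =
      inlRing U V (groupSum O) * inrRing U V (groupSum O') +
        inlRing U V (groupSum a) * inrRing U V (groupSum b') := by
    rw [groupSum_add, groupSum_prod, groupSum_prod]
  have mula : groupSum (fun p : U × V => a p.1 * E' p.2 + O p.1 * a' p.2) =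
      inlRing U V (groupSum a) * inrRing U V (groupSum E') +
        inlRing U V (groupSum O) * inrRing U V (groupSum a') := by
    rw [groupSum_add, groupSum_prod, groupSum_prod]
  have mulb : groupSum (fun p : U × V => b p.1 * O' p.2 + E p.1 * b' p.2) =
      inlRing U V (groupSum b) * inrRing U V (groupSum O') +
        inlRing U V (groupSum E) * inrRing U V (groupSum b') := by
    rw [groupSum_add, groupSum_prod, groupSum_prod]
  set E₁ := inlRing U V (groupSum E)
  set O₁ := inlRing U V (groupSum O)
  set a₁ := inlRing U V (groupSum a)
  set b₁ := inlRing U V (groupSum b)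
  set E₂ := inrRing U V (groupSum E')
  set O₂ := inrRing U V (groupSum O')
  set a₂ := inrRing U V (groupSum a')
  set b₂ := inrRing U V (groupSum b')
  set J₁ := inlRing U V (allSum U)
  set J₂ := inrRing U V (allSum V)
  constructor
  · constructor
    · rintro ⟨x, y⟩; simp [h.neg_E, h'.neg_E, h.neg_b, h'.neg_a]
    · rintro ⟨x, y⟩; simp [h.neg_O, h'.neg_O, h.neg_a, h'.neg_b]
    · rintro ⟨x, y⟩; simp [h.neg_O, h'.neg_E, h.neg_a, h'.neg_a]
    · rintro ⟨x, y⟩; simp [h.neg_E, h'.neg_O, h.neg_b, h'.neg_b]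
    · rintro ⟨x, y⟩
      rcases h.values x with ⟨rfl, e1, e2, e3, e4⟩ | ⟨z, e1, e2, e3, e4⟩ | ⟨z, e1, e2, e3, e4⟩ <;>
      rcases h'.values y with ⟨rfl, f1, f2, f3, f4⟩ | ⟨w, f1, f2, f3, f4⟩ | ⟨w, f1, f2, f3, f4⟩ <;>
      simp [*, mul_pow]
    · rw [mula, mulb, Fintype.card_prod, allSum_prod]
      push_cast
      linear_combination 2 * E₂ * a₂ * r3 + 2 * O₂ * b₂ * r4 + E₂ ^ 2 * r6 + O₁ ^ 2 * s6
        + O₂ ^ 2 * r7 + E₁ ^ 2 * s7 + (E₂ ^ 2 + O₂ ^ 2 - J₂) * r1 + Fintype.card U * s1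
    · rw [mulE, mulO, Fintype.card_prod, allSum_prod]
      push_cast
      linear_combination 2 * E₂ * a₂ * r4 + 2 * O₂ * b₂ * r3 + a₂ ^ 2 * r7 + b₂ ^ 2 * r6
        + (O₁ ^ 2 - J₁) * s6 + (E₁ ^ 2 - J₁) * s7 + (E₂ ^ 2 + O₂ ^ 2 - J₂) * r1
        + Fintype.card U * s1
  · rw [mula, mulb]
    linear_combination E₂ * O₂ * r2
      + a₁ * E₁ * s4
      + O₁ * b₁ * s3
      + O₁ * E₁ * s2
  · rw [mula, mulO]
    linear_combination E₂ * O₂ * r3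
      + a₁ ^ 2 * s4 + O₁ ^ 2 * s3
      + O₁ * a₁ * s2
  · rw [mulb, mulE]
    linear_combination E₂ * O₂ * r4
      + b₁ ^ 2 * s3 + E₁ ^ 2 * s4
      + E₁ * b₁ * s2
  · rw [mulE, mulO, allSum_prod]
    linear_combination E₂ * O₂ * r5 + J₁ * s5
      + a₁ * E₁ * s4
      + O₁ * b₁ * s3
      + a₂ * b₂ * r2
  · rw [mula, mulE, allSum_prod]
    linear_combination 2 * E₂ * a₂ * (r3 - r4)
      + E₂ ^ 2 * r6
      - a₂ ^ 2 * r7 + J₁ * s6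
  · rw [mulb, mulO, allSum_prod]
    linear_combination 2 * O₂ * b₂ * (r4 - r3)
      + O₂ ^ 2 * r7
      - b₂ ^ 2 * r6 + J₁ * s7

end Product

/-! ### Eight blocks from two quadruples, or from a quadruple and the cyclic group of order five -/

/-- Four even functions that are `0` at the origin and `±1` elsewhere, with squares adding up to
`4 (|G| - J)`, give a family of type `H₈*`: changing the value at the origin to `1` turns `S i` and
`-S i` into sign functions, and in the sum of the squares of `1 + S i` and `1 - S i` the linear
terms cancel. -/
lemma exists_family_of_four {G : Type} [AddCommGroup G] [Fintype G] [DecidableEq G]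
    (S : Fin 4 → G → ℤ) (h0 : ∀ i, S i 0 = 0) (h1 : ∀ i x, x ≠ 0 → S i x ^ 2 = 1)
    (hs : ∀ i x, S i (-x) = S i x)
    (h : ∑ i, groupSum (S i) ^ 2 = 4 * ((Fintype.card G : AddMonoidAlgebra ℤ G) - allSum G)) :
    ∃ B : Fin 8 → Finset G, IsSymmetricFamily B ∧ IsTypeHStar B := by
  have plus : ∀ i, groupSum (fun x => (if x = 0 then 1 else 0) + S i x) = 1 + groupSum (S i) := by
    intro i; rw [groupSum_add, groupSum_delta]
  have minus : ∀ i, groupSum (fun x => (if x = 0 then 1 else 0) - S i x) = 1 - groupSum (S i) := by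
    intro i; rw [groupSum_sub, groupSum_delta]
  refine exists_family_of_signs
    (fun i => Fin.addCases (m := 4) (n := 4) (motive := fun _ => G → ℤ)
      (fun i x => (if x = 0 then 1 else 0) + S i x)
      (fun i x => (if x = 0 then 1 else 0) - S i x) i) (fun i x => ?_) (fun i x => ?_) ?_
  · refine Fin.addCases (m := 4) (n := 4) (fun i => ?_) (fun i => ?_) i <;>
    simp only [Fin.addCases_left, Fin.addCases_right] <;>
    rcases eq_or_ne x 0 with rfl | hx
    · simp [h0]
    · rw [if_neg hx, zero_add, h1 i x hx]
    · simp [h0]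
    · rw [if_neg hx, zero_sub, neg_sq, h1 i x hx]
  · refine Fin.addCases (m := 4) (n := 4) (fun i => ?_) (fun i => ?_) i <;>
    simp only [Fin.addCases_left, Fin.addCases_right, hs, neg_eq_zero]
  · rw [Fin.sum_univ_add (a := 4) (b := 4)]
    simp only [Fin.addCases_left, Fin.addCases_right, plus, minus]
    rw [← Finset.sum_add_distrib]
    have : ∀ i, (1 + groupSum (S i)) ^ 2 + (1 - groupSum (S i)) ^ 2 =
        2 + 2 * groupSum (S i) ^ 2 := fun i => by ring
    simp only [this, Finset.sum_add_distrib, ← Finset.mul_sum, h]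
    simp
    ring

/-- For two quadruples, the four functions `(aE' + bO') ± (Eb' + Oa')` and `(aO' - bE') ± (Ea' - Ob')`
have disjoint summands that cover everything but the origin, and in the sum of their squares all
mixed terms cancel. -/
theorem exists_family_of_quadruples {U V : Type} [AddCommGroup U] [Fintype U] [DecidableEq U]
    [AddCommGroup V] [Fintype V] [DecidableEq V] {E O a b : U → ℤ} {E' O' a' b' : V → ℤ}
    (h : IsSignQuadruple E O a b) (h' : IsSignQuadruple E' O' a' b') :
    ∃ B : Fin 8 → Finset (U × V), IsSymmetricFamily B ∧ IsTypeHStar B := by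
  have r1 := congrArg (inlRing U V) h.sq_ab
  have r2 := congrArg (inlRing U V) h.sq_EO
  have s1 := congrArg (inrRing U V) h'.sq_ab
  have s2 := congrArg (inrRing U V) h'.sq_EO
  simp only [map_add, map_sub, map_pow, map_natCast] at r1 r2 s1 s2
  have cells : ∀ x : U × V, x ≠ 0 → ∀ s : ℤ, s ^ 2 = 1 →
      (a x.1 * E' x.2 + b x.1 * O' x.2 + s * (E x.1 * b' x.2 + O x.1 * a' x.2)) ^ 2 = 1 ∧
      (a x.1 * O' x.2 - b x.1 * E' x.2 + s * (E x.1 * a' x.2 - O x.1 * b' x.2)) ^ 2 = 1 := by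
    rintro ⟨x, y⟩ hxy s hs
    rcases h.values x with ⟨z, e1, e2, e3, e4⟩ | ⟨z, e1, e2, e3, e4⟩ | ⟨z, e1, e2, e3, e4⟩ <;>
    rcases h'.values y with ⟨w, f1, f2, f3, f4⟩ | ⟨w, f1, f2, f3, f4⟩ | ⟨w, f1, f2, f3, f4⟩ <;>
    first
    | exact absurd (Prod.mk_eq_zero.2 ⟨z, w⟩) hxy
    | simp [e1, e2, e3, e4, f1, f2, f3, f4, mul_pow, hs]
  refine exists_family_of_four (G := U × V)
    ![fun x => a x.1 * E' x.2 + b x.1 * O' x.2 + (E x.1 * b' x.2 + O x.1 * a' x.2),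
      fun x => a x.1 * E' x.2 + b x.1 * O' x.2 - (E x.1 * b' x.2 + O x.1 * a' x.2),
      fun x => a x.1 * O' x.2 - b x.1 * E' x.2 + (E x.1 * a' x.2 - O x.1 * b' x.2),
      fun x => a x.1 * O' x.2 - b x.1 * E' x.2 - (E x.1 * a' x.2 - O x.1 * b' x.2)] ?_ ?_ ?_ ?_
  · have e3 : a 0 = 0 := by
      rcases h.values 0 with ⟨-, -, -, e, -⟩ | ⟨z, -⟩ | ⟨z, -⟩ <;> first | exact e | exact absurd rfl z
    have e4 : b 0 = 0 := by
      rcases h.values 0 with ⟨-, -, -, -, e⟩ | ⟨z, -⟩ | ⟨z, -⟩ <;> first | exact e | exact absurd rfl z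
    have f3 : a' 0 = 0 := by
      rcases h'.values 0 with ⟨-, -, -, e, -⟩ | ⟨z, -⟩ | ⟨z, -⟩ <;> first | exact e | exact absurd rfl z
    have f4 : b' 0 = 0 := by
      rcases h'.values 0 with ⟨-, -, -, -, e⟩ | ⟨z, -⟩ | ⟨z, -⟩ <;> first | exact e | exact absurd rfl z
    simp [Fin.forall_fin_succ, e3, e4, f3, f4]
  · intro i x hx
    have p := cells x hx 1 (by norm_num)
    have m := cells x hx (-1) (by norm_num)
    simp only [one_mul, neg_one_mul, ← sub_eq_add_neg] at p m
    fin_cases i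
    exacts [p.1, m.1, p.2, m.2]
  · intro i x
    fin_cases i <;>
      simp [h.neg_E, h.neg_O, h.neg_a, h.neg_b, h'.neg_E, h'.neg_O, h'.neg_a, h'.neg_b]
  · simp only [Fin.sum_univ_four, Matrix.cons_val]
    simp only [groupSum_add, groupSum_sub, groupSum_prod, Fintype.card_prod, allSum_prod]
    push_cast
    linear_combination
      2 * (inrRing U V (groupSum E') ^ 2 + inrRing U V (groupSum O') ^ 2) * r1
      + 2 * (inrRing U V (groupSum a') ^ 2 + inrRing U V (groupSum b') ^ 2) * r2
      + 2 * (Fintype.card U - inlRing U V (allSum U)) * s2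
      + 2 * (Fintype.card U + inlRing U V (allSum U)) * s1

/-- The quadratic character modulo five, as a plain function. -/
def paleyFive (y : ZMod 5) : ℤ := if y = 0 then 0 else if y = 1 ∨ y = 4 then 1 else -1

/-- With `j` the sum of the elements of `ZMod 5`, `p` the quadratic character and
`p² = 5 - j`, the eight functions `C (j - 2) + X ± Y p` for
`(X, Y, C) = (1 + b, E, a), (1 - b, E, -a), (1 + a, O, -b), (1 - a, O, b)` are sign functions. The
sum of the squares collapses because `(j - 2)² = j + 4` and `p² = 5 - j`. -/
theorem exists_family_of_quadruple_five {U : Type} [AddCommGroup U] [Fintype U] [DecidableEq U]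
    {E O a b : U → ℤ} (h : IsSignQuadruple E O a b) :
    ∃ B : Fin 8 → Finset (U × ZMod 5), IsSymmetricFamily B ∧ IsTypeHStar B := by
  set F : (U → ℤ) → (U → ℤ) → (U → ℤ) → U × ZMod 5 → ℤ := fun C X Y x =>
    C x.1 * (1 - 2 * (if x.2 = 0 then 1 else 0)) + ((if x.1 = 0 then 1 else 0) + X x.1) *
      (if x.2 = 0 then 1 else 0) + Y x.1 * paleyFive x.2 with hF
  have hneg : ∀ C X Y : U → ℤ, (∀ x, C (-x) = C x) → (∀ x, X (-x) = X x) →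
      (∀ x, Y (-x) = Y x) → ∀ x, F C X Y (-x) = F C X Y x := by
    rintro C X Y hC hX hY ⟨x, y⟩
    have : paleyFive (-y) = paleyFive y := by revert y; decide
    simp [hF, hC, hX, hY, this]
  have hval : ∀ C X Y : U → ℤ,
      (∀ x, (x = 0 ∧ C x = 0 ∧ X x = 0 ∧ Y x ^ 2 = 1) ∨
        (x ≠ 0 ∧ C x = 0 ∧ X x ^ 2 = 1 ∧ Y x ^ 2 = 1) ∨
        (x ≠ 0 ∧ C x ^ 2 = 1 ∧ X x = 0 ∧ Y x = 0)) → ∀ x, F C X Y x ^ 2 = 1 := by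
    rintro C X Y hv ⟨x, y⟩
    have : paleyFive y ^ 2 = if y = 0 then 0 else 1 := by revert y; decide
    have p0 : paleyFive 0 = 0 := by decide
    rcases eq_or_ne y 0 with hy | hy <;>
    rcases hv x with ⟨rfl, e1, e2, e3⟩ | ⟨z, e1, e2, e3⟩ | ⟨z, e1, e2, e3⟩ <;>
    simp only [hy, if_true, if_false] at this <;>
    simp [F, *, mul_pow]
  have hsum : ∀ C X Y : U → ℤ, groupSum (F C X Y) =
      inlRing U _ (groupSum C) * (inrRing U _ (allSum (ZMod 5)) - 2) + (1 + inlRing U _ (groupSum X))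
        + inlRing U _ (groupSum Y) * inrRing U _ (groupSum paleyFive) := by
    intro C X Y
    have e : groupSum (fun y : ZMod 5 => 1 - 2 * (if y = 0 then (1 : ℤ) else 0)) =
        allSum (ZMod 5) - 2 := by
      have : groupSum (fun y : ZMod 5 => 2 * (if y = 0 then (1 : ℤ) else 0)) = 2 := by
        simp only [two_mul]
        rw [groupSum_add, groupSum_delta, one_add_one_eq_two]
      rw [groupSum_sub, this, allSum]
    simp only [hF]
    rw [groupSum_add, groupSum_add, groupSum_prod C (fun y : ZMod 5 => 1 - 2 * (if y = 0 then (1 : ℤ) else 0)),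
      groupSum_prod (fun x => (if x = 0 then (1 : ℤ) else 0) + X x) (fun y : ZMod 5 => if y = 0 then (1 : ℤ) else 0),
      groupSum_prod, e, groupSum_add, groupSum_delta, groupSum_delta]
    simp only [map_sub, map_add, map_one, map_ofNat, mul_one]
  have r1 := congrArg (inlRing U (ZMod 5)) h.sq_ab
  have r2 := congrArg (inlRing U (ZMod 5)) h.sq_EO
  have p2 : groupSum paleyFive ^ 2 = 5 - allSum (ZMod 5) := by
    rw [show (5 : AddMonoidAlgebra ℤ (ZMod 5)) = (5 : ℤ) • 1 by simp, ← groupSum_delta, pow_two]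
    ext y
    rw [coeff_groupSum_mul]
    simp only [AddMonoidAlgebra.coeff_sub, AddMonoidAlgebra.coeff_smul, Finsupp.sub_apply,
      Finsupp.smul_apply, coeff_groupSum, coeff_allSum]
    revert y; decide
  have j2 : allSum (ZMod 5) ^ 2 = 5 * allSum (ZMod 5) := by
    rw [show (5 : AddMonoidAlgebra ℤ (ZMod 5)) * allSum (ZMod 5) = (5 : ℤ) • allSum (ZMod 5) by simp,
      pow_two, allSum]
    ext y
    rw [coeff_groupSum_mul]
    simp only [AddMonoidAlgebra.coeff_smul, Finsupp.smul_apply, coeff_groupSum]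
    decide
  replace p2 := congrArg (inrRing U (ZMod 5)) p2
  replace j2 := congrArg (inrRing U (ZMod 5)) j2
  simp only [map_add, map_sub, map_mul, map_pow, map_natCast, map_ofNat] at r1 r2 p2 j2
  set C : Fin 8 → U → ℤ := ![a, a, fun x => -a x, fun x => -a x,
    fun x => -b x, fun x => -b x, b, b] with hC
  set X : Fin 8 → U → ℤ := ![b, b, fun x => -b x, fun x => -b x,
    a, a, fun x => -a x, fun x => -a x] with hX
  set Y : Fin 8 → U → ℤ := ![E, fun x => -E x, E, fun x => -E x,
    O, fun x => -O x, O, fun x => -O x] with hY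
  refine exists_family_of_signs (G := U × ZMod 5) (fun i => F (C i) (X i) (Y i)) ?_ ?_ ?_
  · refine fun i => hval _ _ _ fun x => ?_
    rcases h.values x with ⟨rfl, e1, e2, e3, e4⟩ | ⟨z, e1, e2, e3, e4⟩ | ⟨z, e1, e2, e3, e4⟩ <;>
    fin_cases i <;> simp [C, X, Y, *]
  · refine fun i => hneg _ _ _ ?_ ?_ ?_ <;> intro x <;> fin_cases i <;>
    simp [hC, hX, hY, h.neg_E, h.neg_O, h.neg_a, h.neg_b]
  · simp only [Fin.sum_univ_eight, Matrix.cons_val, hsum, hC, hX, hY, groupSum_neg, map_neg, Fintype.card_prod,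
      allSum_prod, ZMod.card]
    push_cast
    set J₁ := inlRing U (ZMod 5) (allSum U)
    set J₂ := inrRing U (ZMod 5) (allSum (ZMod 5))
    set a₁ := inlRing U (ZMod 5) (groupSum a)
    set b₁ := inlRing U (ZMod 5) (groupSum b)
    set p := inrRing U (ZMod 5) (groupSum paleyFive)
    linear_combination 4 * ((J₂ - 2) ^ 2 + 1) * r1 + 4 * p ^ 2 * r2
      + 4 * (Fintype.card U - J₁) * j2 + 4 * (Fintype.card U + J₁) * p2

/-! ### Orders of groups with quadruples -/

/-- Some abelian group of order `n` carries a sign quadruple. -/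
def HasSignQuadruple (n : ℕ) : Prop :=
  ∃ (U : Type) (_ : AddCommGroup U) (_ : Fintype U) (E O a b : U → ℤ),
    Fintype.card U = n ∧ IsSignQuadruple E O a b

/-- Some abelian group of order `n` carries an orthogonal quadruple. -/
def HasOrthogonalQuadruple (n : ℕ) : Prop :=
  ∃ (U : Type) (_ : AddCommGroup U) (_ : Fintype U) (E O a b : U → ℤ),
    Fintype.card U = n ∧ IsOrthogonalQuadruple E O a b

lemma HasOrthogonalQuadruple.hasSignQuadruple {n : ℕ} (h : HasOrthogonalQuadruple n) :
    HasSignQuadruple n := by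
  obtain ⟨U, _, _, E, O, a, b, hn, h⟩ := h
  exact ⟨U, _, _, E, O, a, b, hn, h.toIsSignQuadruple⟩

lemma HasOrthogonalQuadruple.mul {m n : ℕ} (hm : HasOrthogonalQuadruple m)
    (hn : HasOrthogonalQuadruple n) : HasOrthogonalQuadruple (m * n) := by
  obtain ⟨U, _, _, E, O, a, b, rfl, h⟩ := hm
  obtain ⟨V, _, _, E', O', a', b', rfl, h'⟩ := hn
  exact ⟨U × V, inferInstance, inferInstance, _, _, _, _, Fintype.card_prod U V, h.prod h'⟩

lemma hasOrthogonalQuadruple_one : HasOrthogonalQuadruple 1 := by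
  have h1 : groupSum (fun _ : Unit => 1) = 1 := by
    rw [← groupSum_delta]; congr
  have h0 : groupSum (fun _ : Unit => 0) = 0 := by
    ext; simp
  have hJ : allSum Unit = 1 := h1
  refine ⟨Unit, inferInstance, inferInstance, fun _ => 1, fun _ => 1, fun _ => 0, fun _ => 0,
    rfl, ⟨⟨?_, ?_, ?_, ?_, ?_, ?_, ?_⟩, ?_, ?_, ?_, ?_, ?_, ?_⟩⟩ <;> simp [h1, h0, hJ]

/-- On `ZMod 3 × ZMod 3`, with `L₀, …, L₃` the four lines through the origin, the quadruple
`-(L₁ + L₃ - 3), -(L₀ + L₂ - 3), L₀ - L₂, L₁ - L₃` is orthogonal. Here `L₀` and `L₂` are the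
coordinate axes. -/
lemma hasOrthogonalQuadruple_nine : HasOrthogonalQuadruple 9 := by
  set E : ZMod 3 × ZMod 3 → ℤ := fun x => if x = 0 then 1 else if x.1 = 0 ∨ x.2 = 0 then 0 else -1
    with hE
  set O : ZMod 3 × ZMod 3 → ℤ := fun x => if x = 0 then 1 else if x.1 = 0 ∨ x.2 = 0 then -1 else 0
    with hO
  set a : ZMod 3 × ZMod 3 → ℤ := fun x =>
    if x = 0 then 0 else if x.1 = 0 then 1 else if x.2 = 0 then -1 else 0 with ha
  set b : ZMod 3 × ZMod 3 → ℤ := fun x =>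
    if x.1 = 0 ∨ x.2 = 0 then 0 else if x.1 = x.2 then 1 else -1 with hb
  have hcard : ((Fintype.card (ZMod 3 × ZMod 3) : ℕ) : AddMonoidAlgebra ℤ (ZMod 3 × ZMod 3)) =
      groupSum fun x => if x = 0 then 9 else 0 := by
    have : (groupSum fun x : ZMod 3 × ZMod 3 => if x = 0 then (9 : ℤ) else 0) =
        (9 : ℤ) • groupSum fun x : ZMod 3 × ZMod 3 => if x = 0 then (1 : ℤ) else 0 := by
      ext x
      simp only [AddMonoidAlgebra.coeff_smul, Finsupp.smul_apply, coeff_groupSum]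
      split_ifs <;> rfl
    rw [this, groupSum_delta]
    simp
  refine ⟨ZMod 3 × ZMod 3, inferInstance, inferInstance, E, O, a, b, rfl,
    ⟨⟨?_, ?_, ?_, ?_, ?_, ?_, ?_⟩, ?_, ?_, ?_, ?_, ?_, ?_⟩⟩
  all_goals try decide
  all_goals
    try rw [hcard]
    ext x
    simp only [pow_two, AddMonoidAlgebra.coeff_sub, AddMonoidAlgebra.coeff_add, Finsupp.sub_apply,
      Finsupp.add_apply, coeff_groupSum_mul, coeff_groupSum, coeff_allSum,
      AddMonoidAlgebra.coeff_zero, Finsupp.coe_zero, Pi.zero_apply]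
    revert x
    decide

/-! ### Lines in the plane over a finite field -/

section Lines

variable {K : Type} [Field K]

/-- Representatives of the points of the projective line: `(1, y)` for `some y` and `(0, 1)` for
the point at infinity `none`. -/
def lineRep : Option K → K × K
  | none => (0, 1)
  | some y => (1, y)

lemma lineRep_ne_zero (P : Option K) : lineRep P ≠ 0 := by
  cases P <;> simp [lineRep]

variable [DecidableEq K]

/-- The line through the origin that contains a given nonzero vector. -/
def lineOf (X : K × K) : Option K := if X.1 = 0 then none else some (X.2 / X.1)

lemma lineOf_smul {c : K} (hc : c ≠ 0) (X : K × K) : lineOf (c • X) = lineOf X := by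
  simp [lineOf, hc, mul_div_mul_left]

lemma lineOf_lineRep (P : Option K) : lineOf (lineRep P) = P := by
  cases P <;> simp [lineOf, lineRep]

lemma exists_smul_lineRep {X : K × K} (hX : X ≠ 0) : ∃ c : K, c ≠ 0 ∧ X = c • lineRep (lineOf X) := by
  rcases X with ⟨x, y⟩
  by_cases hx : x = 0
  · refine ⟨y, ?_, ?_⟩
    · rintro rfl; exact hX (by simp [hx])
    · simp [lineOf, lineRep, hx]
  · exact ⟨x, hx, by simp [lineOf, lineRep, hx, mul_div_cancel₀]⟩

lemma det_lineRep_eq_zero_iff {Y : K × K} (hY : Y ≠ 0) (P : Option K) :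
    Y.1 * (lineRep P).2 - Y.2 * (lineRep P).1 = 0 ↔ P = lineOf Y := by
  rcases Y with ⟨s, t⟩
  by_cases hs : s = 0
  · have : t ≠ 0 := by rintro rfl; exact hY (by simp [hs])
    cases P <;> simp [lineRep, lineOf, hs, this]
  · cases P <;> simp [lineRep, lineOf, hs, sub_eq_zero, eq_div_iff, mul_comm]

/-- Summation over the plane line by line; the origin lies on all `|K| + 1` lines. -/
lemma sum_lines [Fintype K] {M : Type*} [AddCommMonoid M] (f : K × K → M) :
    ∑ P : Option K, ∑ c : K, f (c • lineRep P) = ∑ X, f X + Fintype.card K • f 0 := by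
  have h : ∀ c : K, c ≠ 0 → ∑ y, f (c, c * y) = ∑ y, f (c, y) := fun c hc =>
    Equiv.sum_comp (Equiv.mulLeft₀ c hc) fun y => f (c, y)
  rw [Fintype.sum_option, Finset.sum_comm (s := Finset.univ) (t := Finset.univ) (f := fun y c =>
    f (c • lineRep (some y))), Fintype.sum_prod_type,
    ← Finset.add_sum_erase Finset.univ (fun c => ∑ y, f (c • lineRep (some y)))
      (Finset.mem_univ (0 : K)),
    ← Finset.add_sum_erase Finset.univ (fun x => ∑ y, f (x, y)) (Finset.mem_univ (0 : K))]
  have h2 : ∑ c ∈ Finset.univ.erase (0 : K), ∑ y : K, f (c • lineRep (some y)) =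
      ∑ c ∈ Finset.univ.erase (0 : K), ∑ y, f (c, y) := by
    refine Finset.sum_congr rfl fun c hc => ?_
    rw [← h c (Finset.ne_of_mem_erase hc)]
    simp [lineRep]
  rw [h2]
  simp [lineRep]
  abel

end Lines

/-! ### The symplectic Fourier transform on a plane over a finite field -/

section Plane

variable {K : Type} [Field K] [Fintype K]

/-- Evaluation of the group ring of `K × K` at the character `X ↦ ψ (det (Y, X))`. For a function
`f`, the map `Y ↦ planeChar ψ Y (groupSum f)` is the symplectic Fourier transform of `f`. -/
noncomputable def planeChar (ψ : AddChar K ℂ) (Y : K × K) : AddMonoidAlgebra ℤ (K × K) →+* ℂ :=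
  (AddMonoidAlgebra.lift ℤ ℂ (K × K)
    { toFun := fun X => ψ (Y.1 * X.toAdd.2 - Y.2 * X.toAdd.1)
      map_one' := by simp
      map_mul' := fun X X' => by
        rw [← AddChar.map_add_eq_mul]; congr 1; simp; ring }).toRingHom

lemma planeChar_groupSum (ψ : AddChar K ℂ) (Y : K × K) (f : K × K → ℤ) :
    planeChar ψ Y (groupSum f) = ∑ X, (f X : ℂ) * ψ (Y.1 * X.2 - Y.2 * X.1) := by
  rw [groupSum_eq_sum, map_sum]
  refine Finset.sum_congr rfl fun X _ => ?_
  simp [planeChar, AddMonoidAlgebra.lift_single]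

variable [DecidableEq K]

lemma sum_char_mul {ψ : AddChar K ℂ} (hψ : ψ.IsPrimitive) (d : K) :
    ∑ c, ψ (c * d) = if d = 0 then (Fintype.card K : ℂ) else 0 := by
  have := AddChar.sum_mulShift d hψ
  rw [this]; split_ifs <;> simp

lemma sum_planeChar {ψ : AddChar K ℂ} (hψ : ψ.IsPrimitive) (Y : K × K) :
    ∑ X : K × K, ψ (Y.1 * X.2 - Y.2 * X.1) = if Y = 0 then (Fintype.card K : ℂ) ^ 2 else 0 := by
  have h : ∀ X : K × K, ψ (Y.1 * X.2 - Y.2 * X.1) = ψ (X.1 * -Y.2) * ψ (X.2 * Y.1) := fun X => by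
    rw [← AddChar.map_add_eq_mul]; congr 1; ring
  simp only [h]
  rw [Fintype.sum_prod_type, ← Finset.sum_mul_sum Finset.univ Finset.univ (fun x => ψ (x * -Y.2))
    fun y => ψ (y * Y.1), sum_char_mul hψ, sum_char_mul hψ]
  rcases Y with ⟨s, t⟩
  by_cases hs : s = 0 <;> by_cases ht : t = 0 <;> simp [hs, ht, pow_two]

lemma planeChar_allSum {ψ : AddChar K ℂ} (hψ : ψ.IsPrimitive) (Y : K × K) :
    planeChar ψ Y (allSum (K × K)) = if Y = 0 then (Fintype.card K : ℂ) ^ 2 else 0 := by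
  rw [allSum, planeChar_groupSum, ← sum_planeChar hψ]
  simp

/-- Fourier inversion: elements of the group ring are determined by their character values. -/
lemma eq_of_planeChar_eq {ψ : AddChar K ℂ} (hψ : ψ.IsPrimitive) {A B : AddMonoidAlgebra ℤ (K × K)}
    (h : ∀ Y, planeChar ψ Y A = planeChar ψ Y B) : A = B := by
  rw [← sub_eq_zero]
  set f : K × K → ℤ := fun X => (A - B).coeff X with hf
  have hAB : A - B = groupSum f := by ext; rfl
  have h0 : ∀ Y, planeChar ψ Y (groupSum f) = 0 := fun Y => by rw [← hAB, map_sub, h, sub_self]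
  have inv : ∀ Z : K × K, (Fintype.card K : ℂ) ^ 2 * f Z = 0 := by
    intro Z
    have e1 : ∑ Y : K × K, planeChar ψ Y (groupSum f) * ψ (Z.1 * Y.2 - Z.2 * Y.1) = 0 := by
      simp [h0]
    have e2 : ∀ X : K × K, ∑ Y : K × K,
        (f X : ℂ) * ψ (Y.1 * X.2 - Y.2 * X.1) * ψ (Z.1 * Y.2 - Z.2 * Y.1) =
          f X * if X = Z then (Fintype.card K : ℂ) ^ 2 else 0 := by
      intro X
      rw [← Finset.sum_congr rfl fun Y _ => (mul_assoc _ _ _).symm, ← Finset.mul_sum]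
      have := sum_planeChar hψ (Z - X)
      simp only [sub_eq_zero, eq_comm (a := Z)] at this
      rw [← this]
      congr 1
      refine Finset.sum_congr rfl fun Y _ => ?_
      rw [← AddChar.map_add_eq_mul]; congr 1; simp; ring
    simp only [planeChar_groupSum, Finset.sum_mul] at e1
    rw [Finset.sum_comm, Finset.sum_congr rfl fun X _ => e2 X] at e1
    simpa [mul_comm] using e1
  have hQ : (Fintype.card K : ℂ) ^ 2 ≠ 0 := by simp
  rw [hAB]
  ext Z
  have := (mul_eq_zero.1 (inv Z)).resolve_left hQ
  simpa using this

/-! ### Eigenfunctions of the symplectic Fourier transform -/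

/-- A function that is constant on punctured lines, and whose value at the origin is the sum of its
values on all lines, is an eigenfunction of the symplectic Fourier transform. -/
lemma planeChar_of_const_on_lines {ψ : AddChar K ℂ} (hψ : ψ.IsPrimitive) {E : K × K → ℤ}
    (hE : ∀ c : K, c ≠ 0 → ∀ X, E (c • X) = E X) (hsum : ∑ P, E (lineRep P) = E 0) (Y : K × K) :
    planeChar ψ Y (groupSum E) = Fintype.card K * E Y := by
  set d : Option K → K := fun P => Y.1 * (lineRep P).2 - Y.2 * (lineRep P).1 with hd
  have h1 := sum_lines fun X => (E X : ℂ) * ψ (Y.1 * X.2 - Y.2 * X.1)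
  have h2 : ∀ P, ∑ c : K, (E (c • lineRep P) : ℂ) *
      ψ (Y.1 * (c • lineRep P).2 - Y.2 * (c • lineRep P).1) =
      E (lineRep P) * (if d P = 0 then (Fintype.card K : ℂ) else 0) + (E 0 - E (lineRep P)) := by
    intro P
    have h3 : ∀ c : K, (E (c • lineRep P) : ℂ) *
        ψ (Y.1 * (c • lineRep P).2 - Y.2 * (c • lineRep P).1) =
        E (lineRep P) * ψ (c * d P) + if c = 0 then ((E 0 : ℂ) - E (lineRep P)) else 0 := by
      intro c
      rcases eq_or_ne c 0 with rfl | hc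
      · simp
      · rw [hE c hc, if_neg hc, add_zero]
        congr 2
        simp [hd]; ring
    rw [Finset.sum_congr rfl fun c _ => h3 c, Finset.sum_add_distrib, ← Finset.mul_sum,
      sum_char_mul hψ]
    simp
  have hsum' : ∑ P, (E (lineRep P) : ℂ) = E 0 := by exact_mod_cast hsum
  rw [Finset.sum_congr rfl fun P _ => h2 P, Finset.sum_add_distrib, Finset.sum_sub_distrib, hsum',
    ← planeChar_groupSum] at h1
  simp only [mul_ite, mul_zero, Finset.sum_const, Finset.card_univ, Fintype.card_option, nsmul_eq_mul,
    Prod.fst_zero, Prod.snd_zero, sub_self, AddChar.map_zero_eq_one, mul_one,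
    Nat.cast_add, Nat.cast_one] at h1
  have h4 : planeChar ψ Y (groupSum E) =
      ∑ P, if d P = 0 then (E (lineRep P) : ℂ) * Fintype.card K else 0 := by
    linear_combination -h1
  rw [h4]
  rcases eq_or_ne Y 0 with rfl | hY
  · simp [hd, ← Finset.sum_mul, hsum', mul_comm]
  · simp only [hd, det_lineRep_eq_zero_iff hY]
    obtain ⟨c, hc, e⟩ := exists_smul_lineRep hY
    have : E Y = E (lineRep (lineOf Y)) := by
      conv_lhs => rw [e]
      rw [hE c hc]
    rw [Finset.sum_ite_eq' Finset.univ (lineOf Y)]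
    simp [this, mul_comm]

/-- The symplectic Fourier transform of a function that is a multiple of the quadratic character on
every line, in terms of the Gauss sum. -/
lemma planeChar_of_quadratic_on_lines (hK : ringChar K ≠ 2) (ψ : AddChar K ℂ)
    {A : K × K → ℤ}
    (hA : ∀ (c : K) X, A (c • X) = quadraticChar K c * A X) (Y : K × K) :
    planeChar ψ Y (groupSum A) =
      gaussSum ((quadraticChar K).ringHomComp (Int.castRingHom ℂ)) ψ *
        ((∑ P, A (lineRep P) * quadraticChar K (Y.1 * (lineRep P).2 - Y.2 * (lineRep P).1) : ℤ) : ℂ) := by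
  set η := (quadraticChar K).ringHomComp (Int.castRingHom ℂ) with hη
  have hη1 : η ≠ 1 := (MulChar.ringHomComp_ne_one_iff (RingHom.injective_int _)).2
    (quadraticChar_ne_one hK)
  have h1 := sum_lines fun X => (A X : ℂ) * ψ (Y.1 * X.2 - Y.2 * X.1)
  have h0 : A 0 = 0 := by simpa using hA 0 0
  have shift : ∀ d : K, ∑ c, η c * ψ (c * d) = η d * gaussSum η ψ := by
    intro d
    rcases eq_or_ne d 0 with rfl | hd
    · simpa [MulChar.map_zero] using MulChar.sum_eq_zero_of_ne_one hη1
    · have e := gaussSum_mulShift η ψ (Units.mk0 d hd)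
      have sq : η d * η d = 1 := by
        have := quadraticChar_sq_one hd
        simp only [hη, MulChar.ringHomComp_apply]
        rw [← map_mul, ← pow_two, this, map_one]
      rw [← e, Units.val_mk0, ← mul_assoc, sq, one_mul, gaussSum]
      refine Finset.sum_congr rfl fun c _ => ?_
      rw [AddChar.mulShift_apply, mul_comm d]
  have h2 : ∀ P, ∑ c : K, (A (c • lineRep P) : ℂ) *
      ψ (Y.1 * (c • lineRep P).2 - Y.2 * (c • lineRep P).1) =
      A (lineRep P) * (η (Y.1 * (lineRep P).2 - Y.2 * (lineRep P).1) * gaussSum η ψ) := by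
    intro P
    rw [← shift, Finset.mul_sum]
    refine Finset.sum_congr rfl fun c _ => ?_
    rw [hA]
    simp only [hη, MulChar.ringHomComp_apply, Prod.smul_fst, Prod.smul_snd, smul_eq_mul]
    push_cast
    rw [mul_comm (Int.cast (quadraticChar K c) : ℂ), mul_assoc]
    congr 3
    ring_nf
  rw [planeChar_groupSum]
  simp only [h0, Int.cast_zero, zero_mul, smul_zero, add_zero] at h1
  rw [← h1, Finset.sum_congr rfl fun P _ => h2 P]
  push_cast
  rw [Finset.mul_sum]
  refine Finset.sum_congr rfl fun P _ => ?_
  simp [hη, MulChar.ringHomComp_apply]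
  ring

end Plane

/-! ### Completing a pair of partial sign functions to a quadruple -/

lemma Finset.exists_signs_sum_eq_one {α : Type*} [DecidableEq α] {s : Finset α} (hs : Odd s.card) :
    ∃ ε : α → ℤ, (∀ x, ε x ^ 2 = 1) ∧ ∑ x ∈ s, ε x = 1 := by
  obtain ⟨k, hk⟩ := hs
  obtain ⟨t, hts, ht⟩ := Finset.exists_subset_card_eq (show k + 1 ≤ s.card by omega)
  refine ⟨fun x => if x ∈ t then 1 else -1, fun x => ?_, ?_⟩
  · dsimp only; split_ifs <;> rfl
  · have h1 := Finset.card_sdiff_of_subset hts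
    rw [← Finset.sum_sdiff hts, Finset.sum_congr rfl fun x hx => if_pos hx,
      Finset.sum_congr rfl fun x hx => if_neg (Finset.mem_sdiff.1 hx).2]
    simp only [Finset.sum_const, smul_neg, nsmul_eq_mul, mul_one, h1, ht, hk,
      show 2 * k + 1 - (k + 1) = k by omega]
    push_cast
    ring

section Plane

variable {K : Type} [Field K] [Fintype K] [DecidableEq K]

/-- Given an odd number of lines, signs on these lines with sum `1` yield a function supported on
their union which takes the value `1` at the origin, and hence is an eigenfunction of the symplectic
Fourier transform. -/
lemma exists_line_function {p : K × K → Prop} [DecidablePred p]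
    (hp : ∀ c : K, c ≠ 0 → ∀ X, p (c • X) ↔ p X)
    (hodd : Odd (Finset.univ.filter fun P => p (lineRep P)).card) :
    ∃ E : K × K → ℤ, E 0 = 1 ∧ (∀ X, X ≠ 0 → p X → E X ^ 2 = 1) ∧
      (∀ X, X ≠ 0 → ¬p X → E X = 0) ∧ (∀ c : K, c ≠ 0 → ∀ X, E (c • X) = E X) ∧
      ∀ ψ : AddChar K ℂ, ψ.IsPrimitive → ∀ Y,
        planeChar ψ Y (groupSum E) = Fintype.card K * E Y := by
  obtain ⟨ε, hε, hsum⟩ := Finset.exists_signs_sum_eq_one hodd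
  set E : K × K → ℤ := fun X => if X = 0 then 1 else if p X then ε (lineOf X) else 0 with hE
  have hom : ∀ c : K, c ≠ 0 → ∀ X, E (c • X) = E X := by
    intro c hc X
    simp only [hE, smul_eq_zero, hc, false_or, hp c hc, lineOf_smul hc]
  refine ⟨E, if_pos rfl, fun X h0 h1 => ?_, fun X h0 h1 => ?_, hom, fun ψ hψ Y => ?_⟩
  · rw [hE]; simp only [h0, h1, if_true, if_false, hε]
  · simp only [hE, h0, h1, if_false]
  · refine planeChar_of_const_on_lines hψ hom ?_ Y
    simp only [hE, lineRep_ne_zero, if_false, if_true, lineOf_lineRep]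
    rw [← Finset.sum_filter, hsum]

/-- Two even functions `a, b : K × K → {0, ±1}` with complementary supports, both unions of equally
many punctured lines, can be completed to a quadruple as soon as `a² + b² = |K|² - J`. As
`|K| ≡ 1 (mod 4)`, the number of lines in each support is odd. -/
theorem exists_quadruple_of_pair (hK : Fintype.card K % 4 = 1) {ψ : AddChar K ℂ}
    (hψ : ψ.IsPrimitive) {a b : K × K → ℤ} (ha0 : a 0 = 0) (hb0 : b 0 = 0)
    (hna : ∀ X, a (-X) = a X) (hnb : ∀ X, b (-X) = b X)
    (hab : ∀ X, X ≠ 0 → (a X ^ 2 = 1 ∧ b X = 0) ∨ (a X = 0 ∧ b X ^ 2 = 1))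
    (hom : ∀ c : K, c ≠ 0 → ∀ X, a (c • X) = 0 ↔ a X = 0)
    (hbal : ∑ P, (a (lineRep P) ^ 2 - b (lineRep P) ^ 2) = 0)
    (hsq : groupSum a ^ 2 + groupSum b ^ 2 =
      (Fintype.card (K × K) : AddMonoidAlgebra ℤ (K × K)) - allSum (K × K)) :
    ∃ E O : K × K → ℤ, IsSignQuadruple E O a b ∧
      (∀ Y, planeChar ψ Y (groupSum E) = Fintype.card K * E Y) ∧
      ∀ Y, planeChar ψ Y (groupSum O) = Fintype.card K * O Y := by
  classical
  set s : Finset (Option K) := Finset.univ.filter fun P => a (lineRep P) = 0 with hs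
  set t : Finset (Option K) := Finset.univ.filter fun P => ¬a (lineRep P) = 0 with ht
  have hst : s.card + t.card = Fintype.card K + 1 := by
    rw [hs, ht, Finset.card_filter_add_card_filter_not, Finset.card_univ, Fintype.card_option]
  have hts : (t.card : ℤ) - s.card = 0 := by
    rw [← hbal, Finset.sum_sub_distrib, hs, ht, Finset.card_filter, Finset.card_filter]
    push_cast
    congr 1 <;> refine Finset.sum_congr rfl fun P _ => ?_ <;>
    rcases hab _ (lineRep_ne_zero P) with ⟨h1, h2⟩ | ⟨h1, h2⟩ <;> simp [h1, h2]
    · intro h; simp [h] at h1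
    · intro h; simp [h] at h1
  have hodd : Odd s.card := by rw [Nat.odd_iff]; omega
  have hodd' : Odd t.card := by rw [Nat.odd_iff]; omega
  obtain ⟨E, E0, E1, E2, Ehom, EF⟩ := exists_line_function (p := fun X => a X = 0)
    (fun c hc X => hom c hc X) hodd
  obtain ⟨O, O0, O1, O2, Ohom, OF⟩ := exists_line_function (p := fun X => ¬a X = 0)
    (fun c hc X => not_congr (hom c hc X)) hodd'
  refine ⟨E, O, ⟨fun X => ?_, fun X => ?_, hna, hnb, fun X => ?_, hsq, ?_⟩, EF ψ hψ, OF ψ hψ⟩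
  · simpa using Ehom (-1) (by simp) X
  · simpa using Ohom (-1) (by simp) X
  · rcases eq_or_ne X 0 with rfl | hX
    · exact Or.inl ⟨rfl, E0, O0, ha0, hb0⟩
    · rcases hab X hX with ⟨h1, h2⟩ | ⟨h1, h2⟩
      · have h : a X ≠ 0 := by intro h; simp [h] at h1
        exact Or.inr (Or.inl ⟨hX, E2 X hX h, O1 X hX h, h1, h2⟩)
      · exact Or.inr (Or.inr ⟨hX, E1 X hX h1, O2 X hX (not_not.2 h1), h1, h2⟩)
  · refine eq_of_planeChar_eq hψ fun Y => ?_
    rw [map_add, map_pow, map_pow, map_add, map_natCast, EF ψ hψ, OF ψ hψ, planeChar_allSum hψ,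
      Fintype.card_prod]
    push_cast
    rcases eq_or_ne Y 0 with rfl | hY
    · simp [E0, O0]; ring
    · by_cases h : a Y = 0
      · have e1 : ((E Y : ℂ)) ^ 2 = 1 := by exact_mod_cast E1 Y hY h
        simp [O2 Y hY (not_not.2 h), hY, mul_pow, e1]; ring
      · have e1 : ((O Y : ℂ)) ^ 2 = 1 := by exact_mod_cast O1 Y hY h
        simp [E2 Y hY h, hY, mul_pow, e1]; ring

/-- If moreover the symplectic Fourier transform interchanges `a` and `b` up to a factor, then the
quadruple is orthogonal. -/
theorem exists_orthogonalQuadruple_of_pair (hK : Fintype.card K % 4 = 1) {ψ : AddChar K ℂ}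
    (hψ : ψ.IsPrimitive) {a b : K × K → ℤ} (ha0 : a 0 = 0) (hb0 : b 0 = 0)
    (hna : ∀ X, a (-X) = a X) (hnb : ∀ X, b (-X) = b X)
    (hab : ∀ X, X ≠ 0 → (a X ^ 2 = 1 ∧ b X = 0) ∨ (a X = 0 ∧ b X ^ 2 = 1))
    (hom : ∀ c : K, c ≠ 0 → ∀ X, a (c • X) = 0 ↔ a X = 0)
    (hbal : ∑ P, (a (lineRep P) ^ 2 - b (lineRep P) ^ 2) = 0)
    {κ : ℂ} (hκ : κ ^ 2 = (Fintype.card K : ℂ) ^ 2)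
    (hFa : ∀ Y, planeChar ψ Y (groupSum a) = κ * b Y)
    (hFb : ∀ Y, planeChar ψ Y (groupSum b) = κ * a Y) :
    ∃ E O : K × K → ℤ, IsOrthogonalQuadruple E O a b := by
  have hsq : groupSum a ^ 2 + groupSum b ^ 2 =
      (Fintype.card (K × K) : AddMonoidAlgebra ℤ (K × K)) - allSum (K × K) := by
    refine eq_of_planeChar_eq hψ fun Y => ?_
    rw [map_add, map_pow, map_pow, map_sub, map_natCast, hFa, hFb, planeChar_allSum hψ,
      Fintype.card_prod]
    push_cast
    rcases eq_or_ne Y 0 with rfl | hY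
    · simp [ha0, hb0]; ring
    · have e : (a Y : ℂ) ^ 2 + (b Y : ℂ) ^ 2 = 1 := by
        rcases hab Y hY with ⟨h1, h2⟩ | ⟨h1, h2⟩ <;> exact_mod_cast (by rw [h1, h2]; rfl)
      rw [if_neg hY]
      linear_combination κ ^ 2 * e + hκ
  obtain ⟨E, O, h, hE, hO⟩ := exists_quadruple_of_pair hK hψ ha0 hb0 hna hnb hab hom hbal hsq
  -- On the transform side every product of members of the quadruple is a pointwise product.
  have cases : ∀ Y, (Y = 0 ∧ (E Y : ℂ) = 1 ∧ (O Y : ℂ) = 1 ∧ (a Y : ℂ) = 0 ∧ (b Y : ℂ) = 0) ∨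
      (Y ≠ 0 ∧ (E Y : ℂ) = 0 ∧ (O Y : ℂ) ^ 2 = 1 ∧ (a Y : ℂ) ^ 2 = 1 ∧ (b Y : ℂ) = 0) ∨
      (Y ≠ 0 ∧ (E Y : ℂ) ^ 2 = 1 ∧ (O Y : ℂ) = 0 ∧ (a Y : ℂ) = 0 ∧ (b Y : ℂ) ^ 2 = 1) :=
    fun Y => by exact_mod_cast h.values Y
  refine ⟨E, O, h, ?_, ?_, ?_, ?_, ?_, ?_⟩ <;> refine eq_of_planeChar_eq hψ fun Y => ?_ <;>
    simp only [map_mul, map_sub, map_pow, map_zero, hE, hO, hFa, hFb, planeChar_allSum hψ, mul_pow,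
      hκ] <;>
    rcases cases Y with ⟨rfl, e1, e2, e3, e4⟩ | ⟨z, e1, e2, e3, e4⟩ | ⟨z, e1, e2, e3, e4⟩ <;>
    simp [*, pow_two]

end Plane

/-! ### Quadratic extensions of finite fields -/

section QuadraticExtension

variable {F K : Type} [Field F] [Fintype F] [Field K] [Fintype K] [Algebra F K]

lemma exists_primitive_addChar (K : Type) [Field K] [Finite K] :
    ∃ ψ : AddChar K ℂ, ψ.IsPrimitive := by
  obtain ⟨ψ, hψ⟩ := (AddChar.exists_apply_ne_zero (a := (1 : K))).2 one_ne_zero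
  exact ⟨ψ, AddChar.IsPrimitive.of_ne_one fun h => hψ (by rw [h]; rfl)⟩

lemma ringChar_ne_two_of_odd_card (hF : Odd (Fintype.card F)) : ringChar F ≠ 2 := fun h => by
  have := FiniteField.even_card_of_char_two h
  rw [Nat.odd_iff] at hF
  omega

lemma isSquare_algebraMap_of_card_eq_sq (hF : Odd (Fintype.card F))
    (hK : Fintype.card K = Fintype.card F ^ 2) (x : F) : IsSquare (algebraMap F K x) := by
  rcases eq_or_ne x 0 with rfl | hx
  · simp
  have hK' : Odd (Fintype.card K) := hK ▸ hF.pow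
  rw [FiniteField.isSquare_iff (ringChar_ne_two_of_odd_card hK') (by simpa using hx), ← map_pow]
  obtain ⟨k, hk⟩ := hF
  have : Fintype.card K / 2 = (Fintype.card F - 1) * (k + 1) := by
    rw [hK, hk, show (2 * k + 1) ^ 2 = 2 * (2 * k * (k + 1)) + 1 by ring]
    simp only [Nat.add_sub_cancel]
    omega
  rw [this, pow_mul, FiniteField.pow_card_sub_one_eq_one x hx, one_pow, map_one]

/-- A basis `1, ω` of a quadratic extension. -/
lemma exists_linearEquiv_prod (hK : Fintype.card K = Fintype.card F ^ 2) :
    ∃ (ω : K) (e : (F × F) ≃ₗ[F] K), ∀ p, e p = algebraMap F K p.1 + algebraMap F K p.2 * ω := by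
  have hns : ¬Function.Surjective (algebraMap F K) := fun h => by
    have h1 := Fintype.card_le_of_surjective _ h
    have h2 : 1 < Fintype.card F := Fintype.one_lt_card
    rw [hK] at h1
    nlinarith
  obtain ⟨ω, hω⟩ := not_forall.1 hns
  set f : (F × F) →ₗ[F] K :=
    { toFun := fun p => algebraMap F K p.1 + algebraMap F K p.2 * ω
      map_add' := fun p q => by simp; ring
      map_smul' := fun c p => by simp [Algebra.smul_def]; ring } with hf
  have hinj : Function.Injective f := by
    rw [injective_iff_map_eq_zero]
    rintro ⟨x, z⟩ h
    have h' : algebraMap F K x + algebraMap F K z * ω = 0 := h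
    have hz : z = 0 := by
      by_contra hz
      refine hω ⟨-x / z, ?_⟩
      have : algebraMap F K z ≠ 0 := by simpa using hz
      rw [map_div₀, map_neg, div_eq_iff this]
      linear_combination -h'
    subst hz
    simpa using h'
  have hbij : Function.Bijective f :=
    (Fintype.bijective_iff_injective_and_card f).2
      ⟨hinj, by rw [Fintype.card_prod, hK, pow_two]⟩
  exact ⟨ω, LinearEquiv.ofBijective f hbij, fun p => rfl⟩

lemma sum_second_coordinate (e : (F × F) ≃ₗ[F] K) (h : F → ℤ) :
    ∑ y, h (e.symm y).2 = Fintype.card F * ∑ z, h z := by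
  rw [← e.bijective.sum_comp, Fintype.sum_prod_type]
  simp

/-- The second coordinates of `y` and `γ y` are independent if `γ` is a nonsquare, as `γ` is then
not in `F`. -/
lemma sum_mul_second_coordinate (hF : Odd (Fintype.card F))
    (hK : Fintype.card K = Fintype.card F ^ 2) {ω : K} {e : (F × F) ≃ₗ[F] K}
    (he : ∀ p, e p = algebraMap F K p.1 + algebraMap F K p.2 * ω) {γ : K} (hγ : ¬IsSquare γ)
    (h : F → ℤ) :
    ∑ y, h (e.symm y).2 * h (e.symm (γ * y)).2 = (∑ z, h z) ^ 2 := by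
  set f : K → F × F := fun y => ((e.symm y).2, (e.symm (γ * y)).2) with hf
  have mem : ∀ y, (e.symm y).2 = 0 → ∃ x : F, y = algebraMap F K x := fun y hy => by
    refine ⟨(e.symm y).1, ?_⟩
    have := he (e.symm y)
    simpa [hy] using this
  have hinj : Function.Injective f := by
    intro y y' hyy
    simp only [hf, Prod.mk.injEq] at hyy
    obtain ⟨x, hx⟩ := mem (y - y') (by simp [hyy.1])
    obtain ⟨x', hx'⟩ := mem (γ * (y - y')) (by simp [mul_sub, hyy.2])
    rw [hx] at hx'
    by_contra hne
    have hx0 : algebraMap F K x ≠ 0 := by rw [← hx]; exact sub_ne_zero.2 hne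
    refine hγ ?_
    have : γ = algebraMap F K (x' / x) := by rw [map_div₀, eq_div_iff hx0, hx']
    rw [this]
    exact isSquare_algebraMap_of_card_eq_sq hF hK _
  have hbij : Function.Bijective f := (Fintype.bijective_iff_injective_and_card f).2
    ⟨hinj, by rw [Fintype.card_prod, hK, pow_two]⟩
  have := Equiv.sum_comp (Equiv.ofBijective f hbij) fun p => h p.1 * h p.2
  rw [Fintype.sum_prod_type, ← Finset.sum_mul_sum Finset.univ Finset.univ h h, ← pow_two] at this
  rw [← this]
  rfl

variable [DecidableEq K]

lemma quadraticChar_algebraMap (hF : Odd (Fintype.card F))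
    (hK : Fintype.card K = Fintype.card F ^ 2) {x : F} (hx : x ≠ 0) :
    quadraticChar K (algebraMap F K x) = 1 :=
  (quadraticChar_one_iff_isSquare (by simpa using hx)).2 (isSquare_algebraMap_of_card_eq_sq hF hK x)

lemma quadraticChar_neg (hF : Odd (Fintype.card F))
    (hK : Fintype.card K = Fintype.card F ^ 2) (y : K) :
    quadraticChar K (-y) = quadraticChar K y := by
  have := quadraticChar_algebraMap (K := K) hF hK (x := -1) (by simp)
  rw [← neg_one_mul, map_mul]
  simp at this
  simp [this]

variable [DecidableEq F]

/-- Sums of the quadratic character of `K` over the translates of the subfield `F`: the character is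
`1` on nonzero elements of `F`, and by homogeneity the sums over the other translates coincide. -/
lemma sum_quadraticChar_translate (hF : Odd (Fintype.card F))
    (hK : Fintype.card K = Fintype.card F ^ 2) {ω : K} {e : (F × F) ≃ₗ[F] K}
    (he : ∀ p, e p = algebraMap F K p.1 + algebraMap F K p.2 * ω) (d : F) :
    ∑ x, quadraticChar K (e (x, d)) = if d = 0 then (Fintype.card F : ℤ) - 1 else -1 := by
  have h0 : ∑ x, quadraticChar K (e (x, 0)) = (Fintype.card F : ℤ) - 1 := by
    have : ∀ x : F, quadraticChar K (e (x, 0)) = 1 - if x = 0 then 1 else 0 := by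
      intro x
      rcases eq_or_ne x 0 with rfl | hx
      · simp [he]
      · simp [he, hx, quadraticChar_algebraMap hF hK hx]
    rw [Finset.sum_congr rfl fun x _ => this x, Finset.sum_sub_distrib]
    simp
  have hd : ∀ d : F, d ≠ 0 →
      ∑ x, quadraticChar K (e (x, d)) = ∑ x, quadraticChar K (e (x, 1)) := by
    intro d hd
    rw [← Equiv.sum_comp (Equiv.mulLeft₀ d hd)]
    refine Finset.sum_congr rfl fun x _ => ?_
    have : e (d * x, d) = algebraMap F K d * e (x, 1) := by
      simp [he]; ring
    rw [show Equiv.mulLeft₀ d hd x = d * x from rfl, this, map_mul, quadraticChar_algebraMap hF hK hd, one_mul]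
  have htot : ∑ d : F, ∑ x, quadraticChar K (e (x, d)) = 0 := by
    rw [Finset.sum_comm, ← Fintype.sum_prod_type (f := fun p => quadraticChar K (e p)),
      e.bijective.sum_comp fun y => quadraticChar K y]
    exact quadraticChar_sum_zero (ringChar_ne_two_of_odd_card (hK ▸ hF.pow))
  rw [← Finset.add_sum_erase _ _ (Finset.mem_univ (0 : F)), h0,
    Finset.sum_congr rfl fun d h => hd d (Finset.ne_of_mem_erase h)] at htot
  simp only [Finset.sum_const, Finset.card_erase_of_mem (Finset.mem_univ _), Finset.card_univ,
    nsmul_eq_mul] at htot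
  have h1 : 1 < Fintype.card F := Fintype.one_lt_card
  push_cast [h1.le] at htot
  have h2 : ((Fintype.card F : ℤ) - 1) * (1 + ∑ x, quadraticChar K (e (x, 1))) = 0 := by
    linear_combination htot
  have h3 : (Fintype.card F : ℤ) - 1 ≠ 0 := by omega
  have h4 := (mul_eq_zero.1 h2).resolve_left h3
  split_ifs with h
  · rw [h, h0]
  · rw [hd d h]; linarith

/-- Convolution with the quadratic character acts on functions of the second coordinate as the
scalar `|F|`, up to a constant. -/
lemma sum_mul_quadraticChar_sub (hF : Odd (Fintype.card F))
    (hK : Fintype.card K = Fintype.card F ^ 2) {ω : K} {e : (F × F) ≃ₗ[F] K}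
    (he : ∀ p, e p = algebraMap F K p.1 + algebraMap F K p.2 * ω) (h : F → ℤ) (t : K) :
    ∑ y, h (e.symm y).2 * quadraticChar K (y - t) =
      Fintype.card F * h (e.symm t).2 - ∑ z, h z := by
  obtain ⟨⟨x₀, z₀⟩, rfl⟩ := e.surjective t
  rw [← e.bijective.sum_comp, Fintype.sum_prod_type, Finset.sum_comm]
  have h1 : ∀ z, ∑ x, h (e.symm (e (x, z))).2 *
      quadraticChar K (e (x, z) - e (x₀, z₀)) =
      h z * if z = z₀ then (Fintype.card F : ℤ) - 1 else -1 := by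
    intro z
    have := sum_quadraticChar_translate hF hK he (z - z₀)
    simp only [sub_eq_zero] at this
    rw [← this, Finset.mul_sum, ← Equiv.sum_comp (Equiv.addRight x₀)]
    refine Finset.sum_congr rfl fun x _ => ?_
    simp [← map_sub, -quadraticChar_apply]
  rw [Finset.sum_congr rfl fun z _ => h1 z]
  have h2 : ∀ z, h z * (if z = z₀ then (Fintype.card F : ℤ) - 1 else -1) =
      (if z = z₀ then Fintype.card F * h z else 0) - h z := by
    intro z; split_ifs <;> ring
  rw [Finset.sum_congr rfl fun z _ => h2 z, Finset.sum_sub_distrib]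
  simp

end QuadraticExtension

/-! ### Orthogonal quadruples on groups of fourth power order -/

section FourthPower

variable {K : Type} [Field K] [Fintype K] [DecidableEq K]

/-- The function on the plane that equals `v P` at the representative of each line `P` and is a
multiple of the quadratic character on every line. -/
def quadraticExtend (v : Option K → ℤ) (X : K × K) : ℤ :=
  quadraticChar K (if X.1 = 0 then X.2 else X.1) * v (lineOf X)

lemma quadraticExtend_smul (v : Option K → ℤ) (c : K) (X : K × K) :
    quadraticExtend v (c • X) = quadraticChar K c * quadraticExtend v X := by
  rcases eq_or_ne c 0 with rfl | hc
  · simp [quadraticExtend]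
  · rw [quadraticExtend, quadraticExtend, lineOf_smul hc, ← mul_assoc, ← map_mul]
    by_cases h : X.1 = 0 <;> simp [h, hc]

lemma quadraticExtend_zero (v : Option K → ℤ) : quadraticExtend v 0 = 0 := by
  simp [quadraticExtend]

lemma quadraticExtend_lineRep (v : Option K → ℤ) (P : Option K) :
    quadraticExtend v (lineRep P) = v P := by
  rw [quadraticExtend, lineOf_lineRep]
  cases P <;> simp [lineRep]

lemma quadraticExtend_sq {v : Option K → ℤ} (hv : ∀ P, v P ^ 2 = 1) {X : K × K} (hX : X ≠ 0) :
    quadraticExtend v X ^ 2 = 1 := by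
  rw [quadraticExtend, mul_pow, hv, mul_one]
  refine quadraticChar_sq_one ?_
  split_ifs with h
  · exact fun h2 => hX (Prod.ext h h2)
  · exact h

/-- An eigenvector of the conference matrix `(η (det (P, R)))` on the projective line extends to an
eigenfunction of the symplectic Fourier transform. -/
lemma planeChar_quadraticExtend (hK : ringChar K ≠ 2) (ψ : AddChar K ℂ) {v : Option K → ℤ} {m : ℤ}
    (hv : ∀ R : Option K, ∑ P, v P * quadraticChar K
      ((lineRep R).1 * (lineRep P).2 - (lineRep R).2 * (lineRep P).1) = m * v R) (Y : K × K) :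
    planeChar ψ Y (groupSum (quadraticExtend v)) =
      gaussSum ((quadraticChar K).ringHomComp (Int.castRingHom ℂ)) ψ * m * quadraticExtend v Y := by
  rw [planeChar_of_quadratic_on_lines hK ψ (quadraticExtend_smul v), mul_assoc]
  congr 1
  simp only [quadraticExtend_lineRep]
  rcases eq_or_ne Y 0 with rfl | hY
  · simp [quadraticExtend_zero]
  · obtain ⟨c, hc, e⟩ := exists_smul_lineRep hY
    set R := lineOf Y
    rw [e, quadraticExtend_smul, quadraticExtend_lineRep]
    have : ∀ P, v P * quadraticChar K ((c • lineRep R).1 * (lineRep P).2 -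
        (c • lineRep R).2 * (lineRep P).1) = quadraticChar K c * (v P * quadraticChar K
      ((lineRep R).1 * (lineRep P).2 - (lineRep R).2 * (lineRep P).1)) := by
      intro P
      rw [mul_left_comm, ← map_mul]
      congr 2
      simp; ring
    rw [Finset.sum_congr rfl fun P _ => this P, ← Finset.mul_sum, hv]
    push_cast; ring

/-- Two sign vectors in the eigenspaces of the conference matrix of the projective line over `K`
for the eigenvalues `|F|` and `-|F|`, orthogonal to each other. They are obtained from a function
on `K` that is constant on the translates of `F`, and from its composition with multiplication by a
nonsquare. -/
lemma exists_conference_eigenvectors {F : Type} [Field F] [Fintype F] [Algebra F K]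
    (hF : Odd (Fintype.card F)) (hK : Fintype.card K = Fintype.card F ^ 2) :
    ∃ v w : Option K → ℤ, (∀ P, v P ^ 2 = 1) ∧ (∀ P, w P ^ 2 = 1) ∧ ∑ P, v P * w P = 0 ∧
      (∀ R : Option K, ∑ P, v P * quadraticChar K
        ((lineRep R).1 * (lineRep P).2 - (lineRep R).2 * (lineRep P).1) =
          (Fintype.card F : ℤ) * v R) ∧
      (∀ R : Option K, ∑ P, w P * quadraticChar K
        ((lineRep R).1 * (lineRep P).2 - (lineRep R).2 * (lineRep P).1) =
          -(Fintype.card F : ℤ) * w R) := by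
  classical
  have hK2 : ringChar K ≠ 2 := ringChar_ne_two_of_odd_card (hK ▸ hF.pow)
  obtain ⟨ω, e, he⟩ := exists_linearEquiv_prod hK
  obtain ⟨h, h1, hsum⟩ := Finset.exists_signs_sum_eq_one (s := (Finset.univ : Finset F))
    (by rwa [Finset.card_univ])
  obtain ⟨γ, hγ⟩ := quadraticChar_exists_neg_one hK2
  have hγ0 : γ ≠ 0 := by rintro rfl; simp at hγ
  have hneg : quadraticChar K (-1) = 1 := by
    rw [quadraticChar_neg hF hK, map_one]
  have conv := sum_mul_quadraticChar_sub hF hK he h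
  have total := sum_second_coordinate e h
  have conv' : ∀ t, ∑ y, h (e.symm (γ * y)).2 * quadraticChar K (y - t) =
      -(Fintype.card F * h (e.symm (γ * t)).2 - 1) := by
    intro t
    rw [← hsum, ← conv, ← Equiv.sum_comp (Equiv.mulLeft₀ γ hγ0) fun y =>
      h (e.symm y).2 * quadraticChar K (y - γ * t), ← Finset.sum_neg_distrib]
    refine Finset.sum_congr rfl fun y _ => ?_
    rw [show Equiv.mulLeft₀ γ hγ0 y = γ * y from rfl, ← mul_sub, map_mul (quadraticChar K) γ, hγ]
    ring
  have total' : ∑ y, h (e.symm (γ * y)).2 = Fintype.card F * ∑ z, h z := by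
    rw [← total, ← Equiv.sum_comp (Equiv.mulLeft₀ γ hγ0) fun y => h (e.symm y).2]; rfl
  refine ⟨fun P => P.elim 1 fun y => h (e.symm y).2,
    fun P => P.elim (-1) fun y => h (e.symm (γ * y)).2, fun P => ?_, fun P => ?_, ?_, fun R => ?_, fun R => ?_⟩
  · cases P with
    | none => rfl
    | some y => exact h1 _
  · cases P with
    | none => rfl
    | some y => exact h1 _
  · rw [Fintype.sum_option]
    have := sum_mul_second_coordinate hF hK he
      (quadraticChar_neg_one_iff_not_isSquare.1 hγ) h
    simp [this, hsum]
  · rw [Fintype.sum_option]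
    cases R with
    | none => simp [lineRep, -quadraticChar_apply, MulChar.map_zero, hneg, total, hsum]
    | some t => simp [lineRep, -quadraticChar_apply, conv, hsum]
  · rw [Fintype.sum_option]
    cases R with
    | none => simp [lineRep, -quadraticChar_apply, MulChar.map_zero, hneg, total', hsum]
    | some t => simp only [Option.elim_none, Option.elim_some, lineRep, mul_one, one_mul, mul_zero,
        sub_zero, map_one, conv']; ring

end FourthPower

/-- The half sum and half difference of the two eigenfunctions have complementary supports and are
interchanged by the symplectic Fourier transform. -/
theorem hasOrthogonalQuadruple_fourth_power {F K : Type} [Field F] [Fintype F] [Field K] [Fintype K]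
    [Algebra F K] (hF : Odd (Fintype.card F)) (hK : Fintype.card K = Fintype.card F ^ 2) :
    HasOrthogonalQuadruple (Fintype.card F ^ 4) := by
  classical
  have hK2 : ringChar K ≠ 2 := ringChar_ne_two_of_odd_card (hK ▸ hF.pow)
  obtain ⟨v, w, hv, hw, hvw, ev, ew⟩ := exists_conference_eigenvectors hF hK
  obtain ⟨ψ, hψ⟩ := exists_primitive_addChar K
  set g := gaussSum ((quadraticChar K).ringHomComp (Int.castRingHom ℂ)) ψ with hg
  have hneg : quadraticChar K (-1) = 1 := by
    rw [quadraticChar_neg hF hK, map_one]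
  have hg2 : g ^ 2 = Fintype.card K := by
    rw [hg, gaussSum_sq ((MulChar.ringHomComp_ne_one_iff (RingHom.injective_int _)).2
      (quadraticChar_ne_one hK2)) ((quadraticChar_isQuadratic K).comp _) hψ,
      MulChar.ringHomComp_apply, hneg, map_one, one_mul]
  set V := quadraticExtend v with hV
  set W := quadraticExtend w with hW
  set a : K × K → ℤ := fun X => (V X + W X) / 2 with ha
  set b : K × K → ℤ := fun X => (V X - W X) / 2 with hb
  have sgn : ∀ X, X ≠ 0 → (V X = 1 ∨ V X = -1) ∧ (W X = 1 ∨ W X = -1) := fun X hX =>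
    ⟨sq_eq_one_iff.1 (quadraticExtend_sq hv hX),
      sq_eq_one_iff.1 (quadraticExtend_sq hw hX)⟩
  have two_a : ∀ X, 2 * a X = V X + W X := by
    intro X
    rcases eq_or_ne X 0 with rfl | hX
    · simp [ha, hV, hW, quadraticExtend_zero]
    · have := sgn X hX
      simp only [ha]; omega
  have two_b : ∀ X, 2 * b X = V X - W X := by
    intro X
    rcases eq_or_ne X 0 with rfl | hX
    · simp [hb, hV, hW, quadraticExtend_zero]
    · have := sgn X hX
      simp only [hb]; omega
  have hsa : ∀ (c : K) X, a (c • X) = quadraticChar K c * a X := fun c X => by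
    have h1 := two_a (c • X)
    rw [hV, hW, quadraticExtend_smul, quadraticExtend_smul, ← hV, ← hW] at h1
    refine mul_left_cancel₀ (two_ne_zero (α := ℤ)) ?_
    linear_combination h1 - quadraticChar K c * two_a X
  have hsb : ∀ (c : K) X, b (c • X) = quadraticChar K c * b X := fun c X => by
    have h1 := two_b (c • X)
    rw [hV, hW, quadraticExtend_smul, quadraticExtend_smul, ← hV, ← hW] at h1
    refine mul_left_cancel₀ (two_ne_zero (α := ℤ)) ?_
    linear_combination h1 - quadraticChar K c * two_b X
  have FV := planeChar_quadraticExtend hK2 ψ ev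
  have FW := planeChar_quadraticExtend hK2 ψ ew
  rw [← hg, ← hV] at FV
  rw [← hg, ← hW] at FW
  have gsa : 2 * groupSum a = groupSum V + groupSum W := by
    rw [two_mul, ← groupSum_add, ← groupSum_add]
    congr 1; ext X; linarith [two_a X]
  have gsb : 2 * groupSum b = groupSum V - groupSum W := by
    rw [two_mul, ← groupSum_add, ← groupSum_sub]
    congr 1; ext X; linarith [two_b X]
  have hQ : Fintype.card K % 4 = 1 := by
    obtain ⟨k, hk⟩ := hF
    rw [hK, hk, show (2 * k + 1) ^ 2 = 4 * (k * (k + 1)) + 1 by ring]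
    omega
  suffices h : ∃ E O : K × K → ℤ, IsOrthogonalQuadruple E O a b by
    obtain ⟨E, O, h⟩ := h
    exact ⟨K × K, inferInstance, inferInstance, E, O, a, b,
      by rw [Fintype.card_prod, hK]; ring, h⟩
  refine exists_orthogonalQuadruple_of_pair hQ hψ (κ := g * Fintype.card F)
    ?_ ?_ ?_ ?_ ?_ ?_ ?_ ?_ ?_ ?_
  · simpa using hsa 0 0
  · simpa using hsb 0 0
  · intro X
    simpa [hneg, -quadraticChar_apply] using hsa (-1) X
  · intro X
    simpa [hneg, -quadraticChar_apply] using hsb (-1) X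
  · intro X hX
    have h1 := two_a X
    have h2 := two_b X
    rcases sgn X hX with ⟨h3 | h3, h4 | h4⟩ <;> rw [h3, h4] at h1 h2
    · exact Or.inl ⟨by rw [show a X = 1 by linarith]; rfl, by linarith⟩
    · exact Or.inr ⟨by linarith, by rw [show b X = 1 by linarith]; rfl⟩
    · exact Or.inr ⟨by linarith, by rw [show b X = -1 by linarith]; rfl⟩
    · exact Or.inl ⟨by rw [show a X = -1 by linarith]; rfl, by linarith⟩
  · intro c hc X
    rw [hsa, mul_eq_zero, quadraticChar_eq_zero_iff]
    simp [hc]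
  · rw [← hvw]
    refine Finset.sum_congr rfl fun P _ => ?_
    have h1 := two_a (lineRep P)
    have h2 := two_b (lineRep P)
    simp only [hV, hW, quadraticExtend_lineRep] at h1 h2
    refine mul_left_cancel₀ (four_ne_zero (α := ℤ)) ?_
    linear_combination (2 * a (lineRep P) + v P + w P) * h1 - (2 * b (lineRep P) + v P - w P) * h2
  · rw [mul_pow, hg2, hK]
    push_cast; ring
  · intro Y
    have h1 := congrArg (planeChar ψ Y) gsa
    simp only [map_add, map_mul, map_ofNat, FV, FW] at h1
    have h2 : (2 : ℂ) * b Y = V Y - W Y := by exact_mod_cast two_b Y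
    push_cast at h1
    linear_combination (1 / 2 : ℂ) * h1 - (1 / 2 : ℂ) * g * Fintype.card F * h2
  · intro Y
    have h1 := congrArg (planeChar ψ Y) gsb
    simp only [map_sub, map_mul, map_ofNat, FV, FW] at h1
    have h2 : (2 : ℂ) * a Y = V Y + W Y := by exact_mod_cast two_a Y
    push_cast at h1
    linear_combination (1 / 2 : ℂ) * h1 - (1 / 2 : ℂ) * g * Fintype.card F * h2

/-! ### Quadruples on groups of square order from quartic characters -/

section Quartic

variable {L : Type} [Field L] [Fintype L]

lemma exists_quartic_mulChar (hL : Fintype.card L % 4 = 1) :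
    ∃ θ : MulChar L GaussianInt, orderOf θ = 4 := by
  refine MulChar.exists_mulChar_orderOf L (ζ := (⟨0, 1⟩ : GaussianInt)) (by omega) ?_
  refine IsPrimitiveRoot.mk_of_lt _ (by norm_num) (by decide) ?_
  intro l h0 h4
  interval_cases l <;> decide

lemma GaussianInt.values_of_pow_four_eq_one {z : GaussianInt} (hz : z ^ 4 = 1) :
    (z.re ^ 2 = 1 ∧ z.im = 0) ∨ (z.re = 0 ∧ z.im ^ 2 = 1) := by
  have hn : z.norm ^ 4 = 1 := by
    have := congrArg Zsqrtd.normMonoidHom hz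
    rwa [map_pow, map_one] at this
  have h1 : z.norm = z.re ^ 2 + z.im ^ 2 := by rw [Zsqrtd.norm_def]; ring
  have h0 : 0 ≤ z.norm := by rw [h1]; positivity
  have h2 : z.norm = 1 := by
    exact (pow_eq_one_iff_of_nonneg h0 (by norm_num)).1 hn
  rw [h1] at h2
  rcases eq_or_ne z.im 0 with h | h
  · left; rw [h] at h2; exact ⟨by linarith, h⟩
  · right
    have : 0 < z.im ^ 2 := by positivity
    have h3 : z.re ^ 2 = 0 := by nlinarith [sq_nonneg z.re]
    exact ⟨by simpa using h3, by linarith⟩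

lemma GaussianInt.re_sum {ι : Type*} (s : Finset ι) (f : ι → GaussianInt) :
    (∑ i ∈ s, f i).re = ∑ i ∈ s, (f i).re :=
  map_sum (⟨⟨Zsqrtd.re, rfl⟩, fun _ _ => rfl⟩ : GaussianInt →+ ℤ) f s

/-- The autocorrelation of a nontrivial even multiplicative character. -/
lemma sum_mulChar_mul_inv_sub {R : Type*} [CommRing R] [IsDomain R] [DecidableEq L]
    {θ : MulChar L R} (hθ : θ ≠ 1) (hneg : θ (-1) = 1) (g : L) :
    ∑ x, θ x * θ⁻¹ (g - x) = if g = 0 then (Fintype.card L : R) - 1 else -1 := by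
  have inv : ∀ x : L, x ≠ 0 → θ x * θ⁻¹ x = 1 := fun x hx => by
    rw [← MulChar.mul_apply, mul_inv_cancel, MulChar.one_apply hx.isUnit]
  have hneg' : θ⁻¹ (-1) = 1 := by
    have := inv (-1) (by simp)
    rwa [hneg, one_mul] at this
  split_ifs with hg
  · subst hg
    have : ∀ x : L, θ x * θ⁻¹ (0 - x) = 1 - if x = 0 then 1 else 0 := by
      intro x
      rcases eq_or_ne x 0 with rfl | hx
      · simp [MulChar.map_zero]
      · rw [zero_sub, ← neg_one_mul, map_mul, hneg', one_mul, inv x hx, if_neg hx, sub_zero]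
    rw [Finset.sum_congr rfl fun x _ => this x, Finset.sum_sub_distrib]
    simp
  · rw [← Equiv.sum_comp (Equiv.mulLeft₀ g hg)]
    have : ∀ x : L, θ (Equiv.mulLeft₀ g hg x) * θ⁻¹ (g - Equiv.mulLeft₀ g hg x) =
        θ x * θ⁻¹ (1 - x) := by
      intro x
      rw [show Equiv.mulLeft₀ g hg x = g * x from rfl, show g - g * x = g * (1 - x) by ring,
        map_mul, map_mul]
      linear_combination θ x * θ⁻¹ (1 - x) * inv g hg
    rw [Finset.sum_congr rfl fun x _ => this x]
    have := jacobiSum_nontrivial_inv hθ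
    rwa [hneg, jacobiSum] at this

/-- The real and imaginary parts of a quartic character of the quadratic extension `L` of `K`,
transported to `K × K`, are supported on unions of equally many lines, because the square of the
character is trivial on `K`. -/
theorem hasSignQuadruple_sq {K L : Type} [Field K] [Fintype K] [Field L] [Fintype L]
    [Algebra K L] (hK : Fintype.card K % 4 = 1) (hL : Fintype.card L = Fintype.card K ^ 2) :
    HasSignQuadruple (Fintype.card K ^ 2) := by
  classical
  have hodd : Odd (Fintype.card K) := by rw [Nat.odd_iff]; omega
  obtain ⟨θ, hθ⟩ := exists_quartic_mulChar (L := L) (by rw [hL, Nat.pow_mod, hK])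
  obtain ⟨ω, e, he⟩ := exists_linearEquiv_prod hL
  obtain ⟨ψ, hψ⟩ := exists_primitive_addChar K
  have hθ1 : θ ≠ 1 := by rintro rfl; simp at hθ
  have hθ2 : θ ^ 2 ≠ 1 := fun h => by
    have := orderOf_dvd_of_pow_eq_one h
    rw [hθ] at this; omega
  have pow4 : ∀ x : L, x ≠ 0 → θ x ^ 4 = 1 := fun x hx => by
    rw [← MulChar.pow_apply' _ (by norm_num), ← hθ, pow_orderOf_eq_one,
      MulChar.one_apply hx.isUnit]
  have sqK : ∀ c : K, c ≠ 0 → θ (algebraMap K L c) ^ 2 = 1 := fun c hc => by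
    obtain ⟨d, hd⟩ := isSquare_algebraMap_of_card_eq_sq hodd hL c
    have hd0 : d ≠ 0 := by
      rintro rfl
      exact hc (by simpa using hd)
    rw [hd, map_mul, ← pow4 d hd0]; ring
  have hneg : θ (-1) = 1 := by
    -- `-1` is a square in `K`, hence a fourth power in `L`.
    obtain ⟨i, hi⟩ := (FiniteField.isSquare_neg_one_iff (F := K)).2 (by omega)
    have hi0 : i ≠ 0 := by rintro rfl; simp at hi
    have : (-1 : L) = algebraMap K L i ^ 2 := by
      rw [← map_pow, pow_two, ← hi, map_neg, map_one]
    rw [this, map_pow, sqK i hi0]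
  set a : K × K → ℤ := fun X => (θ (e X)).re with ha
  set b : K × K → ℤ := fun X => (θ (e X)).im with hb
  have ne : ∀ X, X ≠ 0 → e X ≠ 0 := fun X hX => by simpa using hX
  have hab : ∀ X, X ≠ 0 → (a X ^ 2 = 1 ∧ b X = 0) ∨ (a X = 0 ∧ b X ^ 2 = 1) := fun X hX =>
    GaussianInt.values_of_pow_four_eq_one (pow4 _ (ne X hX))
  have even : ∀ X, θ (e (-X)) = θ (e X) := fun X => by
    rw [map_neg, ← neg_one_mul (e X), map_mul, hneg, one_mul]
  -- The square of the character is real, and is the difference of the squares of the two parts.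
  have sq : ∀ X, X ≠ 0 → θ (e X) ^ 2 = ((a X ^ 2 - b X ^ 2 : ℤ) : GaussianInt) := by
    intro X hX
    rcases hab X hX with ⟨h1, h2⟩ | ⟨h1, h2⟩ <;> rw [h1, h2]
    · have h3 : (θ (e X)).re * (θ (e X)).re = 1 := by rw [← pow_two]; exact h1
      rw [pow_two]
      ext <;> simp [h3, show (θ (e X)).im = 0 from h2]
    · have h3 : (θ (e X)).im * (θ (e X)).im = 1 := by rw [← pow_two]; exact h2
      rw [pow_two]
      ext <;> simp [h3, show (θ (e X)).re = 0 from h1]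
  have sq_smul : ∀ c : K, c ≠ 0 → ∀ X, X ≠ 0 →
      a (c • X) ^ 2 - b (c • X) ^ 2 = a X ^ 2 - b X ^ 2 := by
    intro c hc X hX
    have h := sq (c • X) (smul_ne_zero hc hX)
    rw [map_smul, Algebra.smul_def, map_mul, mul_pow, sqK c hc, one_mul, sq X hX] at h
    exact_mod_cast h.symm
  have z0 : θ (e 0) = 0 := by rw [map_zero, MulChar.map_zero]
  have ha0 : a 0 = 0 := by simp only [ha, z0]; rfl
  have hb0 : b 0 = 0 := by simp only [hb, z0]; rfl
  have hom : ∀ c : K, c ≠ 0 → ∀ X, a (c • X) = 0 ↔ a X = 0 := by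
    intro c hc X
    rcases eq_or_ne X 0 with rfl | hX
    · simp
    have key : ∀ X, X ≠ 0 → (a X = 0 ↔ a X ^ 2 - b X ^ 2 = -1) := fun X hX => by
      rcases hab X hX with ⟨h1, h2⟩ | ⟨h1, h2⟩
      · have : a X ≠ 0 := fun h => by simp [h] at h1
        simp [this, h1, h2]
      · simp [h1, h2]
    rw [key X hX, key _ (smul_ne_zero hc hX), sq_smul c hc X hX]
  have total : ∑ X, (a X ^ 2 - b X ^ 2) = 0 := by
    have h1 : ∑ y, (θ ^ 2) y = 0 := MulChar.sum_eq_zero_of_ne_one hθ2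
    have h2 : ((∑ X, (a X ^ 2 - b X ^ 2) : ℤ) : GaussianInt) = ∑ y, (θ ^ 2) y := by
      rw [← e.bijective.sum_comp]
      push_cast
      refine Finset.sum_congr rfl fun X _ => ?_
      rw [MulChar.pow_apply' _ (by norm_num)]
      rcases eq_or_ne X 0 with rfl | hX
      · simp [ha0, hb0, MulChar.map_zero]
      · rw [sq X hX]; push_cast; rfl
    rw [h1] at h2
    exact_mod_cast h2
  have hbal : ∑ P, (a (lineRep P) ^ 2 - b (lineRep P) ^ 2) = 0 := by
    have h := sum_lines fun X => a X ^ 2 - b X ^ 2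
    have h2 : ∀ P, ∑ c : K, (a (c • lineRep P) ^ 2 - b (c • lineRep P) ^ 2) =
        ((Fintype.card K : ℤ) - 1) * (a (lineRep P) ^ 2 - b (lineRep P) ^ 2) := by
      intro P
      rw [← Finset.add_sum_erase _ _ (Finset.mem_univ (0 : K)), Finset.sum_congr rfl fun c hc =>
        sq_smul c (Finset.ne_of_mem_erase hc) _ (lineRep_ne_zero P)]
      have h1 : 1 < Fintype.card K := Fintype.one_lt_card
      simp [ha0, hb0, Finset.card_erase_of_mem, h1.le]
      ring
    rw [Finset.sum_congr rfl fun P _ => h2 P, ← Finset.mul_sum, total, ha0, hb0] at h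
    have h1 : 1 < Fintype.card K := Fintype.one_lt_card
    have h3 : ((Fintype.card K : ℤ) - 1) ≠ 0 := by omega
    simpa [h3] using h
  have hsq : groupSum a ^ 2 + groupSum b ^ 2 =
      (Fintype.card (K × K) : AddMonoidAlgebra ℤ (K × K)) - allSum (K × K) := by
    have hcard : (Fintype.card (K × K) : AddMonoidAlgebra ℤ (K × K)) =
        (Fintype.card (K × K) : ℤ) • 1 := by simp
    rw [hcard, ← groupSum_delta]
    ext g
    simp only [pow_two, AddMonoidAlgebra.coeff_sub, AddMonoidAlgebra.coeff_add, Finsupp.sub_apply,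
      Finsupp.add_apply, coeff_groupSum_mul, AddMonoidAlgebra.coeff_smul, Finsupp.smul_apply,
      coeff_groupSum, coeff_allSum]
    have h := sum_mulChar_mul_inv_sub hθ1 hneg (e g)
    rw [← e.bijective.sum_comp] at h
    have inv : ∀ X, θ⁻¹ (e X) = ⟨a X, -b X⟩ := by
      intro X
      rcases eq_or_ne X 0 with rfl | hX
      · rw [map_zero, MulChar.map_zero, ha0, hb0]; rfl
      · have h1 : θ⁻¹ (e X) * θ (e X) = 1 := by
          rw [← MulChar.mul_apply, inv_mul_cancel, MulChar.one_apply (ne X hX).isUnit]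
        have h2 : θ (e X) * ⟨a X, -b X⟩ = 1 := by
          have h3 : a X * a X + b X * b X = 1 := by
            rcases hab X hX with ⟨h1, h2⟩ | ⟨h1, h2⟩ <;> nlinarith
          ext
          · simpa [ha, hb] using h3
          · simp [ha, hb, mul_comm]
        rw [← mul_one (θ⁻¹ (e X)), ← h2, ← mul_assoc, h1, one_mul]
    have h2 := congrArg Zsqrtd.re h
    rw [GaussianInt.re_sum] at h2
    have h3 : ∀ X, (θ (e X) * θ⁻¹ (e g - e X)).re = a X * a (g - X) + b X * b (g - X) := by
      intro X
      rw [← map_sub, inv]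
      simp [ha, hb]
    rw [Finset.sum_congr rfl fun X _ => h3 X, Finset.sum_add_distrib] at h2
    rw [h2, Fintype.card_prod, hL]
    by_cases hg : g = 0
    · simp [hg, pow_two]
    · simp [hg]
  obtain ⟨E, O, h, -, -⟩ := exists_quadruple_of_pair hK hψ ha0 hb0
    (fun X => by simp only [ha, even]) (fun X => by simp only [hb, even]) hab hom hbal hsq
  exact ⟨K × K, inferInstance, inferInstance, E, O, a, b, by rw [Fintype.card_prod, pow_two], h⟩

end Quartic

/-! ### The orders in question -/

lemma hasOrthogonalQuadruple_pow_four {n : ℕ} (hn : Odd n) : HasOrthogonalQuadruple (n ^ 4) := by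
  induction n using Nat.recOnMul with
  | zero => simp at hn
  | one => exact hasOrthogonalQuadruple_one
  | prime p hp =>
    have : Fact p.Prime := ⟨hp⟩
    have := Fintype.ofFinite (GaloisField p 2)
    have h := hasOrthogonalQuadruple_fourth_power (F := ZMod p) (K := GaloisField p 2)
      (by rwa [ZMod.card]) (by rw [ZMod.card, Fintype.card_eq_nat_card, GaloisField.card p 2 two_ne_zero])
    rwa [ZMod.card] at h
  | mul a b iha ihb =>
    rw [Nat.odd_mul] at hn
    rw [mul_pow]
    exact (iha hn.1).mul (ihb hn.2)

lemma hasSignQuadruple_of_mem_Phi1 {u : ℕ} (hu : u ∈ Phi1) : HasSignQuadruple u := by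
  obtain ⟨q, hq, hq4, rfl⟩ := hu
  obtain ⟨p, k, hp, hk, rfl⟩ := (isPrimePow_nat_iff q).1 hq
  have : Fact p.Prime := ⟨hp⟩
  let K := GaloisField p k
  let L := FiniteField.Extension K p 2
  have := Fintype.ofFinite K
  have := Fintype.ofFinite L
  have hK : Fintype.card K = p ^ k := by
    rw [Fintype.card_eq_nat_card, GaloisField.card p k hk.ne']
  have hL : Fintype.card L = Fintype.card K ^ 2 := by
    rw [Fintype.card_eq_nat_card, Fintype.card_eq_nat_card, FiniteField.natCard_extension]
  rw [← hK]
  refine hasSignQuadruple_sq (L := L) ?_ hL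
  rw [hK]
  exact hq4

lemma hasSignQuadruple_of_mem_Phi2 {u : ℕ} (hu : u ∈ Phi2) : HasSignQuadruple u := by
  rcases hu with ⟨n, hn, rfl⟩ | ⟨n, hn, rfl⟩
  · exact (hasOrthogonalQuadruple_pow_four (Nat.odd_iff.2 hn)).hasSignQuadruple
  · exact (hasOrthogonalQuadruple_nine.mul
      (hasOrthogonalQuadruple_pow_four (Nat.odd_iff.2 hn))).hasSignQuadruple

theorem mainTheorem6 (u v : ℕ) (hu : u ∈ Phi1 ∪ Phi2) (hv : v ∈ Phi1 ∪ Phi2 ∪ Phi3) :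
    ∃ (G : Type) (_ : AddCommGroup G) (_ : Fintype G) (_ : DecidableEq G)
      (B : Fin 8 → Finset G),
      Fintype.card G = u * v ∧ IsSymmetricFamily B ∧ IsTypeHStar B := by
  classical
  obtain ⟨U, _, _, E, O, a, b, rfl, h⟩ : HasSignQuadruple u :=
    hu.elim hasSignQuadruple_of_mem_Phi1 hasSignQuadruple_of_mem_Phi2
  rcases hv with hv | rfl
  · obtain ⟨V, _, _, E', O', a', b', rfl, h'⟩ : HasSignQuadruple v :=
      hv.elim hasSignQuadruple_of_mem_Phi1 hasSignQuadruple_of_mem_Phi2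
    obtain ⟨B, hB⟩ := exists_family_of_quadruples h h'
    exact ⟨U × V, inferInstance, inferInstance, inferInstance, B, Fintype.card_prod U V, hB⟩
  · obtain ⟨B, hB⟩ := exists_family_of_quadruple_five h
    exact ⟨U × ZMod 5, inferInstance, inferInstance, inferInstance, B,
      by rw [Fintype.card_prod, ZMod.card], hB⟩
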